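/- Throughout, a 2-category is a strict 2-category and a 2-functor is a strict 2-functor. Let $N_2$ be the nerve of 2-categories, whose $n$-simplices $N_2(\mathcal A)_n$ are the normal lax functors $[n]\to\mathcal A$, and let $C_2:\mathbf{sSet}\to\mathbf{2\text{-}Cat}$ be its left adjoint: $C_2(X)$ is presented by the vertices of $X$ as objects, the edges of $X$ as generating 1-cells, and for each 2-simplex with edges $e_{01},e_{12},e_{02}$ a generating 2-cell $e_{12}\circ e_{01}\Rightarrow e_{02}$, where degenerate edges and degenerate 2-simplices are identities and each 3-simplex imposes equality of the two induced 2-cells $e_{23}\circ e_{12}\circ e_{01}\Rightarrow e_{03}$. Let $\mathrm{Sd}$ be the (barycentric) subdivision functor on simplicial sets. Let $\mathcal I$ be the 2-category generated by one 1-cell $L\to R$, with only identity 2-cells. For 2-functors $F,G:\mathcal A\to\mathcal B$, a distortion $\varepsilon:F\rightsquigarrow G$ is a normal lax functor $\mathcal A\times\mathcal I\to\mathcal B$ whose restrictions to $\mathcal A\times\{L\}$ and $\mathcal A\times\{R\}$ are $F$ and $G$. The identity distortion of $F$ is the composite $\mathcal A\times\mathcal I\to\mathcal A\xrightarrow{F}\mathcal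 B$, and for a 2-functor $H:\mathcal A'\to\mathcal A$ the distortion $\varepsilon H:FH\rightsquigarrow GH$ is the composite of $H\times\mathcal I$ with $\varepsilon$. An inclusion $\mathcal A\subseteq\mathcal B$ of 2-categories is a left (respectively right) ideal if every 2-cell of $\mathcal B$ whose 0-dimensional codomain (respectively domain) is an object of $\mathcal A$ is a 2-cell of $\mathcal A$. An inclusion $J:\mathcal A\rightarrowtail\mathcal B$ (a 2-functor injective on 0-, 1- and 2-cells) is a skew immersion if $\mathcal A$ is a left ideal in $\mathcal B$ and there is a right ideal $\mathcal W\subseteq\mathcal B$ containing $\mathcal A$ such that the corestriction $J:\mathcal A\rightarrowtail\mathcal W$ admits a retraction $R:\mathcal W\to\mathcal A$ (a 2-functor with $R\circ J=\mathrm{id}_{\mathcal A}$) and a distortion $\varepsilon:J\circ R\rightsquigarrow\mathrm{id}_{\mathcal W}$ with $\varepsilon J=\mathrm{id}_J$. **Lemma.** Let $n\ge 0$, $0\le k\le n$, and let $i_{k,n}:\Lambda^k[n]\to\Delta[n]$ be the horn inclusion (with $\Lambda^0[0]=\emptyset$). Then the 2-functor $$C_2(\mathrm{Sd}^2(i_{k,n})):C_2(\mathrm{Sd}^2(\Lambda^k[n]))\to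 C_2(\mathrm{Sd}^2(\Delta[n]))$$ is a skew immersion. -/

import Mathlib

open CategoryTheory Bicategory

universe w v u w' v' u'

/-! ## Strict 2-categories presented by generating 2-cells and relations -/

namespace TwoPresentation

section

variable {C : Type u} [Category.{v} C] (G : ∀ ⦃x y : C⦄, (x ⟶ y) → (x ⟶ y) → Type w)

/-- Formal 2-cells generated by a family `G` of 2-cells between the arrows of a category `C`. -/
inductive PreCell : ∀ {x y : C}, (x ⟶ y) → (x ⟶ y) → Type (max u v w)
  | gen {x y : C} {f g : x ⟶ y} (a : G f g) : PreCell f g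
  | eqTo {x y : C} {f g : x ⟶ y} (h : f = g) : PreCell f g
  | vcomp {x y : C} {f g h : x ⟶ y} (a : PreCell f g) (b : PreCell g h) : PreCell f h
  | whiskerL {x y z : C} (f : x ⟶ y) {g h : y ⟶ z} (a : PreCell g h) : PreCell (f ≫ g) (f ≫ h)
  | whiskerR {x y z : C} {f g : x ⟶ y} (a : PreCell f g) (h : y ⟶ z) : PreCell (f ≫ h) (g ≫ h)

/-- A family of relations between parallel formal 2-cells. -/
abbrev PreCellRel := ∀ ⦃x y : C⦄ ⦃f g : x ⟶ y⦄, PreCell G f g → PreCell G f g → Prop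

variable {G}

open PreCell

/-- The relations imposed on formal 2-cells: the given relations `r`, stability under the
operations, and the axioms of a strict 2-category. -/
inductive Rel (r : PreCellRel G) :
    ∀ {x y : C} {f g : x ⟶ y}, PreCell G f g → PreCell G f g → Prop
  | rel {x y : C} {f g : x ⟶ y} {a b : PreCell G f g} (h : r a b) : Rel r a b
  | vcomp_left {x y : C} {f g h : x ⟶ y} (a : PreCell G f g) {b b' : PreCell G g h}
      (hb : Rel r b b') : Rel r (vcomp a b) (vcomp a b')
  | vcomp_right {x y : C} {f g h : x ⟶ y} {a a' : PreCell G f g} (b : PreCell G g h)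
      (ha : Rel r a a') : Rel r (vcomp a b) (vcomp a' b)
  | whiskerL {x y z : C} (f : x ⟶ y) {g h : y ⟶ z} {a a' : PreCell G g h}
      (ha : Rel r a a') : Rel r (whiskerL f a) (whiskerL f a')
  | whiskerR {x y z : C} {f g : x ⟶ y} {a a' : PreCell G f g} (h : y ⟶ z)
      (ha : Rel r a a') : Rel r (whiskerR a h) (whiskerR a' h)
  | id_vcomp {x y : C} {f g : x ⟶ y} (a : PreCell G f g) : Rel r (vcomp (eqTo rfl) a) a
  | vcomp_id {x y : C} {f g : x ⟶ y} (a : PreCell G f g) : Rel r (vcomp a (eqTo rfl)) a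
  | assoc {x y : C} {f g h k : x ⟶ y} (a : PreCell G f g) (b : PreCell G g h) (c : PreCell G h k) :
      Rel r (vcomp (vcomp a b) c) (vcomp a (vcomp b c))
  | whiskerL_id {x y z : C} (f : x ⟶ y) (g : y ⟶ z) :
      Rel r (whiskerL f (eqTo (rfl : g = g))) (eqTo rfl)
  | whiskerL_vcomp {x y z : C} (f : x ⟶ y) {g h k : y ⟶ z} (a : PreCell G g h) (b : PreCell G h k) :
      Rel r (whiskerL f (vcomp a b)) (vcomp (whiskerL f a) (whiskerL f b))
  | id_whiskerR {x y z : C} (f : x ⟶ y) (g : y ⟶ z) :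
      Rel r (whiskerR (eqTo (rfl : f = f)) g) (eqTo rfl)
  | vcomp_whiskerR {x y z : C} {f g h : x ⟶ y} (a : PreCell G f g) (b : PreCell G g h) (k : y ⟶ z) :
      Rel r (whiskerR (vcomp a b) k) (vcomp (whiskerR a k) (whiskerR b k))
  | id_whiskerL {x y : C} {f g : x ⟶ y} (a : PreCell G f g) :
      Rel r (whiskerL (𝟙 x) a)
        (vcomp (eqTo (Category.id_comp f)) (vcomp a (eqTo (Category.id_comp g).symm)))
  | whiskerR_id {x y : C} {f g : x ⟶ y} (a : PreCell G f g) :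
      Rel r (whiskerR a (𝟙 y))
        (vcomp (eqTo (Category.comp_id f)) (vcomp a (eqTo (Category.comp_id g).symm)))
  | comp_whiskerL {x y z t : C} (f : x ⟶ y) (g : y ⟶ z) {h k : z ⟶ t} (a : PreCell G h k) :
      Rel r (whiskerL (f ≫ g) a)
        (vcomp (eqTo (Category.assoc f g h))
          (vcomp (whiskerL f (whiskerL g a)) (eqTo (Category.assoc f g k).symm)))
  | whiskerR_comp {x y z t : C} {f g : x ⟶ y} (a : PreCell G f g) (h : y ⟶ z) (k : z ⟶ t) :
      Rel r (whiskerR a (h ≫ k))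
        (vcomp (eqTo (Category.assoc f h k).symm)
          (vcomp (whiskerR (whiskerR a h) k) (eqTo (Category.assoc g h k))))
  | whisker_assoc {x y z t : C} (f : x ⟶ y) {g h : y ⟶ z} (a : PreCell G g h) (k : z ⟶ t) :
      Rel r (whiskerR (whiskerL f a) k)
        (vcomp (eqTo (Category.assoc f g k))
          (vcomp (whiskerL f (whiskerR a k)) (eqTo (Category.assoc f h k).symm)))
  | whisker_exchange {x y z : C} {f g : x ⟶ y} {h k : y ⟶ z} (a : PreCell G f g)
      (b : PreCell G h k) :
      Rel r (vcomp (whiskerL f b) (whiskerR a k)) (vcomp (whiskerR a h) (whiskerL g b))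

end

variable {C : Type u} [Category.{v} C] {G : ∀ ⦃x y : C⦄, (x ⟶ y) → (x ⟶ y) → Type w}

/-- The strict 2-category with underlying category `C`, presented by the generating 2-cells `G`
and the relations `r`. -/
structure Presented (r : PreCellRel G) where
  /-- The underlying object of `C`. -/
  as : C

variable {r : PreCellRel G}

instance : CategoryStruct (Presented r) where
  Hom x y := x.as ⟶ y.as
  id x := 𝟙 x.as
  comp f g := CategoryStruct.comp (obj := C) f g

/-- 2-cells: formal 2-cells modulo the relations. -/
def Cell {x y : C} (r : PreCellRel G) (f g : x ⟶ y) : Type (max u v w) :=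
  Quot (Rel r (f := f) (g := g))

namespace Cell

/-- The class of a formal 2-cell. -/
def mk {x y : C} (r : PreCellRel G) {f g : x ⟶ y} (a : PreCell G f g) : Cell r f g := Quot.mk _ a

/-- Vertical composition. -/
def vcomp {x y : C} {f g h : x ⟶ y} (a : Cell r f g) (b : Cell r g h) : Cell r f h :=
  Quot.map₂ PreCell.vcomp (fun a _ _ hb => Rel.vcomp_left a hb)
    (fun _ _ b ha => Rel.vcomp_right b ha) a b

/-- Left whiskering. -/
def whiskerL {x y z : C} (f : x ⟶ y) {g h : y ⟶ z} (a : Cell r g h) :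
    Cell r (f ≫ g) (f ≫ h) :=
  Quot.map (PreCell.whiskerL f) (fun _ _ ha => Rel.whiskerL f ha) a

/-- Right whiskering. -/
def whiskerR {x y z : C} {f g : x ⟶ y} (a : Cell r f g) (h : y ⟶ z) :
    Cell r (f ≫ h) (g ≫ h) :=
  Quot.map (fun a => PreCell.whiskerR a h) (fun _ _ ha => Rel.whiskerR h ha) a

end Cell

instance (x y : Presented r) : Category (x ⟶ y) where
  Hom f g := Cell (x := x.as) (y := y.as) r f g
  id f := Cell.mk (x := x.as) (y := y.as) r (PreCell.eqTo (rfl : f = f))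
  comp a b := Cell.vcomp a b
  id_comp := by rintro f g ⟨a⟩; exact Quot.sound (.id_vcomp a)
  comp_id := by rintro f g ⟨a⟩; exact Quot.sound (.vcomp_id a)
  assoc := by rintro f g h k ⟨a⟩ ⟨b⟩ ⟨c⟩; exact Quot.sound (.assoc a b c)

lemma mk_eqTo {x y : Presented r} {f g : x ⟶ y} (h : f = g) :
    (Cell.mk (x := x.as) (y := y.as) r (PreCell.eqTo h) : f ⟶ g) = eqToHom h := by
  subst h; rfl

/-- The isomorphism given by an equality of 1-cells. -/
def eqIso {x y : Presented r} {f g : x ⟶ y} (h : f = g) : f ≅ g where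
  hom := Cell.mk (x := x.as) (y := y.as) r (PreCell.eqTo h)
  inv := Cell.mk (x := x.as) (y := y.as) r (PreCell.eqTo h.symm)
  hom_inv_id := by subst h; exact Category.id_comp (𝟙 f)
  inv_hom_id := by subst h; exact Category.id_comp (𝟙 f)

lemma eqIso_eq {x y : Presented r} {f g : x ⟶ y} (h : f = g) : eqIso h = eqToIso h := by
  subst h; rfl

lemma whiskerL_eq {x y z : Presented r} (f : x ⟶ y) {g h : y ⟶ z} (e : g = h) :
    (Cell.whiskerL (r := r) (x := x.as) (y := y.as) (z := z.as) f (eqToHom e) :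
      CategoryStruct.comp (obj := Presented r) f g ⟶ f ≫ h) = eqToHom (congrArg (f ≫ ·) e) := by
  subst e; exact Quot.sound (.whiskerL_id _ _)

lemma whiskerR_eq {x y z : Presented r} {f g : x ⟶ y} (e : f = g) (h : y ⟶ z) :
    (Cell.whiskerR (r := r) (x := x.as) (y := y.as) (z := z.as) (eqToHom e) h :
      CategoryStruct.comp (obj := Presented r) f h ⟶ g ≫ h) = eqToHom (congrArg (· ≫ h) e) := by
  subst e; exact Quot.sound (.id_whiskerR _ _)

instance : Bicategory (Presented r) where
  whiskerLeft {x y z} f {_ _} a := Cell.whiskerL (x := x.as) (y := y.as) (z := z.as) f a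
  whiskerRight {x y z} {_ _} a h := Cell.whiskerR (x := x.as) (y := y.as) (z := z.as) a h
  associator {x y z t} f g h :=
    eqIso (r := r) (x := x) (y := t) (Category.assoc (obj := C) f g h)
  leftUnitor {x y} f := eqIso (r := r) (x := x) (y := y) (Category.id_comp (obj := C) f)
  rightUnitor {x y} f := eqIso (r := r) (x := x) (y := y) (Category.comp_id (obj := C) f)
  whiskerLeft_id f g := Quot.sound (Rel.whiskerL_id (C := C) f g)
  whiskerLeft_comp := by rintro _ _ _ f g h k ⟨a⟩ ⟨b⟩; exact Quot.sound (.whiskerL_vcomp f a b)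
  id_whiskerLeft := by rintro _ _ f g ⟨a⟩; exact Quot.sound (.id_whiskerL a)
  comp_whiskerLeft := by rintro _ _ _ _ f g h k ⟨a⟩; exact Quot.sound (.comp_whiskerL f g a)
  id_whiskerRight f g := Quot.sound (Rel.id_whiskerR (C := C) f g)
  comp_whiskerRight := by
    rintro _ _ _ f g h ⟨a⟩ ⟨b⟩ k; exact Quot.sound (.vcomp_whiskerR a b k)
  whiskerRight_id := by rintro _ _ f g ⟨a⟩; exact Quot.sound (.whiskerR_id a)
  whiskerRight_comp := by rintro _ _ _ _ f g ⟨a⟩ h k; exact Quot.sound (.whiskerR_comp a h k)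
  whisker_assoc := by rintro _ _ _ _ f g h ⟨a⟩ k; exact Quot.sound (.whisker_assoc f a k)
  whisker_exchange := by
    rintro _ _ _ f g h k ⟨a⟩ ⟨b⟩; exact Quot.sound (.whisker_exchange a b)
  pentagon f g h k := by
    simp only [eqIso_eq, eqToIso.hom]
    erw [whiskerL_eq, whiskerR_eq]
    simp
  triangle f g := by
    simp only [eqIso_eq, eqToIso.hom]
    erw [whiskerL_eq, whiskerR_eq]
    simp

instance : Strict (Presented r) where
  id_comp f := Category.id_comp (obj := C) f
  comp_id f := Category.comp_id (obj := C) f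
  assoc f g h := Category.assoc (obj := C) f g h
  leftUnitor_eqToIso _ := eqIso_eq _
  rightUnitor_eqToIso _ := eqIso_eq _
  associator_eqToIso _ _ _ := eqIso_eq _

/-- The identification of `C` with the underlying category of a 2-category presented over `C`. -/
def underlying (r : PreCellRel G) : C ⥤ Presented r where
  obj x := ⟨x⟩
  map f := f

/-! ### 2-functors out of a presented 2-category -/

section lift

variable {B : Type u'} [Bicategory.{w', v'} B] [Strict B] (F : C ⥤ B)
  (γ : ∀ ⦃x y : C⦄ ⦃f g : x ⟶ y⦄, G f g → (F.map f ⟶ F.map g))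

lemma whiskerLeft_of_eq_id {x y : B} {k : x ⟶ x} (e : k = 𝟙 x) {f g : x ⟶ y} (η : f ⟶ g) :
    k ◁ η = eqToHom (by rw [e, Strict.id_comp]) ≫ η ≫
      eqToHom (by rw [e, Strict.id_comp]) := by
  subst e; simp [Strict.leftUnitor_eqToIso]

lemma whiskerRight_of_eq_id {x y : B} {k : y ⟶ y} (e : k = 𝟙 y) {f g : x ⟶ y} (η : f ⟶ g) :
    η ▷ k = eqToHom (by rw [e, Strict.comp_id]) ≫ η ≫
      eqToHom (by rw [e, Strict.comp_id]) := by
  subst e; simp [Strict.rightUnitor_eqToIso]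

lemma whiskerLeft_of_eq_comp {x y z t : B} {k : x ⟶ z} {f : x ⟶ y} {g : y ⟶ z} (e : k = f ≫ g)
    {h h' : z ⟶ t} (η : h ⟶ h') :
    k ◁ η = eqToHom (by rw [e, Strict.assoc]) ≫ f ◁ g ◁ η ≫
      eqToHom (by rw [e, Strict.assoc]) := by
  subst e; simp [Strict.associator_eqToIso]

lemma whiskerLeft_of_eq {x y z : B} {k k' : x ⟶ y} (e : k = k') {f g : y ⟶ z} (η : f ⟶ g) :
    k ◁ η = eqToHom (by rw [e]) ≫ k' ◁ η ≫ eqToHom (by rw [e]) := by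
  subst e; simp

lemma whiskerRight_of_eq {x y z : B} {k k' : y ⟶ z} (e : k = k') {f g : x ⟶ y} (η : f ⟶ g) :
    η ▷ k = eqToHom (by rw [e]) ≫ η ▷ k' ≫ eqToHom (by rw [e]) := by
  subst e; simp

lemma whiskerRight_of_eq_comp {x y z t : B} {k : y ⟶ t} {f : y ⟶ z} {g : z ⟶ t} (e : k = f ≫ g)
    {h h' : x ⟶ y} (η : h ⟶ h') :
    η ▷ k = eqToHom (by rw [e, Strict.assoc]) ≫ η ▷ f ▷ g ≫
      eqToHom (by rw [e, Strict.assoc]) := by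
  subst e; simp [Strict.associator_eqToIso]

/-- Evaluation of formal 2-cells in a strict 2-category. -/
def evalCell : ∀ {x y : C} {f g : x ⟶ y}, PreCell G f g → (F.map f ⟶ F.map g)
  | _, _, _, _, .gen a => γ a
  | _, _, _, _, .eqTo h => eqToHom (congrArg F.map h)
  | _, _, _, _, .vcomp a b => evalCell a ≫ evalCell b
  | _, _, _, _, .whiskerL f a =>
      eqToHom (F.map_comp _ _) ≫ F.map f ◁ evalCell a ≫ eqToHom (F.map_comp _ _).symm
  | _, _, _, _, .whiskerR a h =>
      eqToHom (F.map_comp _ _) ≫ evalCell a ▷ F.map h ≫ eqToHom (F.map_comp _ _).symm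

lemma evalCell_rel (hγ : ∀ ⦃x y : C⦄ ⦃f g : x ⟶ y⦄ (a b : PreCell G f g), r a b →
      evalCell F γ a = evalCell F γ b)
    {x y : C} {f g : x ⟶ y} {a b : PreCell G f g} (h : Rel r a b) :
    evalCell F γ a = evalCell F γ b := by
  induction h with
  | rel h => exact hγ _ _ h
  | vcomp_left a _ ih => simp only [evalCell, ih]
  | vcomp_right b _ ih => simp only [evalCell, ih]
  | whiskerL f _ ih => simp only [evalCell, ih]
  | whiskerR h _ ih => simp only [evalCell, ih]
  | id_vcomp a => simp [evalCell]
  | vcomp_id a => simp [evalCell]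
  | assoc a b c => simp [evalCell]
  | whiskerL_id f g => simp [evalCell]
  | whiskerL_vcomp f a b => simp [evalCell]
  | id_whiskerR f g => simp [evalCell]
  | vcomp_whiskerR a b k => simp [evalCell]
  | id_whiskerL a => simp [evalCell, whiskerLeft_of_eq_id (F.map_id _)]
  | whiskerR_id a => simp [evalCell, whiskerRight_of_eq_id (F.map_id _)]
  | comp_whiskerL f g a => simp [evalCell, whiskerLeft_of_eq_comp (F.map_comp f g)]
  | whiskerR_comp a h k => simp [evalCell, whiskerRight_of_eq_comp (F.map_comp h k)]
  | whisker_assoc f a k => simp [evalCell, Strict.associator_eqToIso]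
  | whisker_exchange a b => simp [evalCell, whisker_exchange_assoc]

lemma eqToHom_trans₃ {x y : B} {f g h k : x ⟶ y} (p : f = g) (q : g = h) (t : h = k) :
    eqToHom p ≫ eqToHom q ≫ eqToHom t = eqToHom (p.trans (q.trans t)) := by
  subst p q t; simp

lemma tetra_transport {x₀ x₁ x₂ x₃ : C} {a₀₁ : x₀ ⟶ x₁} {a₁₂ : x₁ ⟶ x₂} {a₂₃ : x₂ ⟶ x₃}
    {a₀₂ : x₀ ⟶ x₂} {a₁₃ : x₁ ⟶ x₃} {a₀₃ : x₀ ⟶ x₃}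
    {g₀₁ : F.obj x₀ ⟶ F.obj x₁} {g₁₂ : F.obj x₁ ⟶ F.obj x₂} {g₂₃ : F.obj x₂ ⟶ F.obj x₃}
    {g₀₂ : F.obj x₀ ⟶ F.obj x₂} {g₁₃ : F.obj x₁ ⟶ F.obj x₃} {g₀₃ : F.obj x₀ ⟶ F.obj x₃}
    (p₀₁ : F.map a₀₁ = g₀₁) (p₁₂ : F.map a₁₂ = g₁₂) (p₂₃ : F.map a₂₃ = g₂₃)
    (p₀₂ : F.map a₀₂ = g₀₂) (p₁₃ : F.map a₁₃ = g₁₃) (p₀₃ : F.map a₀₃ = g₀₃)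
    (t₀₁₂ : g₀₁ ≫ g₁₂ ⟶ g₀₂) (t₀₂₃ : g₀₂ ≫ g₂₃ ⟶ g₀₃) (t₁₂₃ : g₁₂ ≫ g₂₃ ⟶ g₁₃)
    (t₀₁₃ : g₀₁ ≫ g₁₃ ⟶ g₀₃)
    (key : t₀₁₂ ▷ g₂₃ ≫ t₀₂₃ = eqToHom (Strict.assoc _ _ _) ≫ g₀₁ ◁ t₁₂₃ ≫ t₀₁₃) :
    (eqToHom (F.map_comp _ _) ≫
      (eqToHom ((F.map_comp _ _).trans (congrArg₂ (· ≫ ·) p₀₁ p₁₂)) ≫ t₀₁₂ ≫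
        eqToHom p₀₂.symm) ▷ F.map a₂₃ ≫ eqToHom (F.map_comp _ _).symm) ≫
      eqToHom ((F.map_comp _ _).trans (congrArg₂ (· ≫ ·) p₀₂ p₂₃)) ≫ t₀₂₃ ≫
        eqToHom p₀₃.symm =
    eqToHom (congrArg F.map (Category.assoc a₀₁ a₁₂ a₂₃)) ≫
      (eqToHom (F.map_comp _ _) ≫
        F.map a₀₁ ◁ (eqToHom ((F.map_comp _ _).trans (congrArg₂ (· ≫ ·) p₁₂ p₂₃)) ≫ t₁₂₃ ≫
          eqToHom p₁₃.symm) ≫ eqToHom (F.map_comp _ _).symm) ≫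
      eqToHom ((F.map_comp _ _).trans (congrArg₂ (· ≫ ·) p₀₁ p₁₃)) ≫ t₀₁₃ ≫
        eqToHom p₀₃.symm := by
  subst p₀₁ p₁₂ p₂₃ p₀₂ p₁₃ p₀₃
  simp [key]

/-- The 2-functor out of a presented 2-category induced by a functor on the underlying category
and an assignment of 2-cells to the generators which respects the relations. -/
def lift (hγ : ∀ ⦃x y : C⦄ ⦃f g : x ⟶ y⦄ (a b : PreCell G f g), r a b →
      evalCell F γ a = evalCell F γ b) :
    StrictPseudofunctor (Presented r) B :=
  StrictPseudofunctor.mk''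
    { obj x := F.obj x.as
      map f := F.map f
      map₂ a := Quot.lift (evalCell F γ) (fun _ _ h => evalCell_rel F γ hγ h) a
      map₂_id _ := rfl
      map₂_comp := by rintro _ _ _ _ _ ⟨a⟩ ⟨b⟩; rfl
      map_id x := F.map_id x.as
      map_comp f g := F.map_comp f g
      map₂_whisker_left := by rintro _ _ _ f _ _ ⟨a⟩; rfl
      map₂_whisker_right := by rintro _ _ _ _ _ ⟨a⟩ h; rfl }

end lift

end TwoPresentation

/-! ## The 2-categorification of a simplicial set

The functor `C₂` left adjoint to the nerve `N₂` of 2-categories, where `N₂(A)_n` is the set of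
normal lax functors `[n] ⟶ A`. A simplicial map `X ⟶ N₂(A)` amounts to an assignment of objects
of `A` to vertices, of 1-cells to edges and of 2-cells `F e₁₂ ∘ F e₀₁ ⟹ F e₀₂` to 2-simplices,
sending degenerate edges and 2-simplices to identities and satisfying the cocycle condition
for every 3-simplex. Hence `C₂ X` is the strict 2-category presented by these data. -/

namespace SSet

open TwoPresentation

/-- Vertices of a simplicial set; with its edges, they form the graph of 1-simplices. -/
structure Vertex (X : SSet.{u}) where
  /-- The underlying 0-simplex. -/
  pt : X.obj (Opposite.op (SimplexCategory.mk 0))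

instance (X : SSet.{u}) : Quiver.{u} (Vertex X) := ⟨fun x y => Edge x.pt y.pt⟩

/-- An edge, as an arrow of the graph of 1-simplices. -/
def Edge.toHom {X : SSet.{u}} {x y : Vertex X} (e : Edge x.pt y.pt) : x ⟶ y := e

/-- Degenerate edges are identified with identities. -/
inductive DegenRel (X : SSet.{u}) : HomRel (Paths (Vertex X))
  | degen (x : Vertex X) :
      DegenRel X ((Paths.of (Vertex X)).map (Edge.id x.pt).toHom) (𝟙 _)

/-- The category freely generated by the graph of 1-simplices, modulo degenerate edges. -/
abbrev OneCells (X : SSet.{u}) := Quotient (DegenRel X)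

variable {X : SSet.{u}}

/-- A vertex, as an object of the category of 1-cells. -/
def ver (x : Vertex X) : OneCells X := ⟨x⟩

/-- The generating 1-cell given by an edge. -/
def arr {x y : Vertex X} (e : Edge x.pt y.pt) : ver x ⟶ ver y :=
  (Quotient.functor (DegenRel X)).map ((Paths.of (Vertex X)).map e.toHom)

lemma arr_id (x : Vertex X) : arr (Edge.id x.pt) = 𝟙 (ver x) :=
  CategoryTheory.Quotient.sound _ (.degen x)

variable (X) in
/-- The generating 2-cells: a 2-simplex with faces `e₁₂`, `e₀₂`, `e₀₁` is a 2-cell from the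
composite of `e₀₁` and `e₁₂` to `e₀₂`. -/
inductive Triangle : ∀ ⦃x y : OneCells X⦄, (x ⟶ y) → (x ⟶ y) → Type u
  | tri {x₀ x₁ x₂ : Vertex X} {e₀₁ : Edge x₀.pt x₁.pt} {e₁₂ : Edge x₁.pt x₂.pt}
      {e₀₂ : Edge x₀.pt x₂.pt} (h : Edge.CompStruct e₀₁ e₁₂ e₀₂) :
      Triangle (arr e₀₁ ≫ arr e₁₂) (arr e₀₂)

/-- The formal 2-cell given by a 2-simplex. -/
def triCell {x₀ x₁ x₂ : Vertex X} {e₀₁ : Edge x₀.pt x₁.pt} {e₁₂ : Edge x₁.pt x₂.pt}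
    {e₀₂ : Edge x₀.pt x₂.pt} (h : Edge.CompStruct e₀₁ e₁₂ e₀₂) :
    PreCell (Triangle X) (arr e₀₁ ≫ arr e₁₂) (arr e₀₂) :=
  .gen (.tri h)

variable (X) in
/-- The relations between 2-cells: degenerate 2-simplices are identities, and for each 3-simplex
the two composites of its faces from `e₀₁ ≫ e₁₂ ≫ e₂₃` to `e₀₃` agree. -/
inductive TetraRel : PreCellRel (Triangle X)
  | degen₀ {x y : Vertex X} (e : Edge x.pt y.pt) :
      TetraRel (triCell (x₀ := x) (x₁ := x) (Edge.CompStruct.idComp e))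
        (.eqTo (by rw [arr_id, Category.id_comp]))
  | degen₁ {x y : Vertex X} (e : Edge x.pt y.pt) :
      TetraRel (triCell (x₁ := y) (x₂ := y) (Edge.CompStruct.compId e))
        (.eqTo (by rw [arr_id, Category.comp_id]))
  | tetra {x₀ x₁ x₂ x₃ : Vertex X} {e₀₁ : Edge x₀.pt x₁.pt} {e₁₂ : Edge x₁.pt x₂.pt}
      {e₂₃ : Edge x₂.pt x₃.pt} {e₀₂ : Edge x₀.pt x₂.pt} {e₁₃ : Edge x₁.pt x₃.pt}
      {e₀₃ : Edge x₀.pt x₃.pt} (h₀₁₂ : Edge.CompStruct e₀₁ e₁₂ e₀₂)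
      (h₀₂₃ : Edge.CompStruct e₀₂ e₂₃ e₀₃) (h₁₂₃ : Edge.CompStruct e₁₂ e₂₃ e₁₃)
      (h₀₁₃ : Edge.CompStruct e₀₁ e₁₃ e₀₃)
      (τ : X.obj (Opposite.op (SimplexCategory.mk 3)))
      (d₃ : X.δ 3 τ = h₀₁₂.simplex) (d₁ : X.δ 1 τ = h₀₂₃.simplex)
      (d₀ : X.δ 0 τ = h₁₂₃.simplex) (d₂ : X.δ 2 τ = h₀₁₃.simplex) :
      TetraRel (.vcomp (.whiskerR (triCell h₀₁₂) (arr e₂₃)) (triCell h₀₂₃))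
        (.vcomp (.eqTo (Category.assoc _ _ _))
          (.vcomp (.whiskerL (arr e₀₁) (triCell h₁₂₃)) (triCell h₀₁₃)))

/-- The 2-categorification of a simplicial set. -/
abbrev C₂ (X : SSet.{u}) := Presented (TetraRel X)

/-- The 1-cell of `C₂ X` given by an edge. -/
def edg {x y : Vertex X} (e : Edge x.pt y.pt) : (⟨ver x⟩ : C₂ X) ⟶ ⟨ver y⟩ := arr e

lemma edg_id (x : Vertex X) : edg (Edge.id x.pt) = 𝟙 (⟨ver x⟩ : C₂ X) := arr_id x

/-- The 2-cell of `C₂ X` given by a 2-simplex. -/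
def tri {x₀ x₁ x₂ : Vertex X} {e₀₁ : Edge x₀.pt x₁.pt} {e₁₂ : Edge x₁.pt x₂.pt}
    {e₀₂ : Edge x₀.pt x₂.pt} (h : Edge.CompStruct e₀₁ e₁₂ e₀₂) :
    edg e₀₁ ≫ edg e₁₂ ⟶ edg e₀₂ :=
  Cell.mk (TetraRel X) (triCell h)

lemma tri_degen₀ {x y : Vertex X} {e₀₁ : Edge x.pt x.pt} {e e' : Edge x.pt y.pt}
    (h : Edge.CompStruct e₀₁ e e') (h₁ : e₀₁ = Edge.id x.pt) (h₂ : e = e')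
    (hs : h.simplex = X.σ 0 e.edge) :
    tri h = eqToHom (by rw [h₁, h₂, edg_id, Strict.id_comp]) := by
  subst h₁ h₂
  obtain rfl : h = Edge.CompStruct.idComp e := Edge.CompStruct.ext hs
  exact (Quot.sound (.rel (.degen₀ e))).trans (mk_eqTo _)

lemma tri_degen₁ {x y : Vertex X} {e₁₂ : Edge y.pt y.pt} {e e' : Edge x.pt y.pt}
    (h : Edge.CompStruct e e₁₂ e') (h₁ : e₁₂ = Edge.id y.pt) (h₂ : e = e')
    (hs : h.simplex = X.σ 1 e.edge) :
    tri h = eqToHom (by rw [h₁, h₂, edg_id, Strict.comp_id]) := by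
  subst h₁ h₂
  obtain rfl : h = Edge.CompStruct.compId e := Edge.CompStruct.ext hs
  exact (Quot.sound (.rel (.degen₁ e))).trans (mk_eqTo _)

lemma tri_tetra {x₀ x₁ x₂ x₃ : Vertex X} {e₀₁ : Edge x₀.pt x₁.pt} {e₁₂ : Edge x₁.pt x₂.pt}
    {e₂₃ : Edge x₂.pt x₃.pt} {e₀₂ : Edge x₀.pt x₂.pt} {e₁₃ : Edge x₁.pt x₃.pt}
    {e₀₃ : Edge x₀.pt x₃.pt} (h₀₁₂ : Edge.CompStruct e₀₁ e₁₂ e₀₂)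
    (h₀₂₃ : Edge.CompStruct e₀₂ e₂₃ e₀₃) (h₁₂₃ : Edge.CompStruct e₁₂ e₂₃ e₁₃)
    (h₀₁₃ : Edge.CompStruct e₀₁ e₁₃ e₀₃)
    (τ : X.obj (Opposite.op (SimplexCategory.mk 3)))
    (d₃ : X.δ 3 τ = h₀₁₂.simplex) (d₁ : X.δ 1 τ = h₀₂₃.simplex)
    (d₀ : X.δ 0 τ = h₁₂₃.simplex) (d₂ : X.δ 2 τ = h₀₁₃.simplex) :
    tri h₀₁₂ ▷ edg e₂₃ ≫ tri h₀₂₃ =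
      eqToHom (Strict.assoc _ _ _) ≫ edg e₀₁ ◁ tri h₁₂₃ ≫ tri h₀₁₃ := by
  rw [← mk_eqTo]
  exact Quot.sound (.rel (.tetra h₀₁₂ h₀₂₃ h₁₂₃ h₀₁₃ τ d₃ d₁ d₀ d₂))

variable {Y : SSet.{u}} (φ : X ⟶ Y)

/-- The functor induced by a simplicial map on the categories of 1-cells. -/
def oneCellsMap : OneCells X ⥤ OneCells Y :=
  CategoryTheory.Quotient.lift _
    (Paths.lift
      { obj x := ver ⟨φ.app _ x.pt⟩
        map e := arr (Edge.map e φ) })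
    (by
      rintro a b f g ⟨x⟩
      refine (Paths.lift_toPath _ _).trans ?_
      refine Eq.trans ?_ (CategoryTheory.Functor.map_id _ _).symm
      refine Eq.trans ?_ (arr_id ⟨φ.app _ x.pt⟩)
      exact congrArg (arr (x := ⟨φ.app _ x.pt⟩) (y := ⟨φ.app _ x.pt⟩)) (Edge.map_id x.pt φ))

/-- The functor from the category of 1-cells of `C₂ X` to the underlying category of `C₂ Y`. -/
def C₂.map₁ : OneCells X ⥤ C₂ Y := oneCellsMap φ ⋙ underlying (TetraRel Y)

lemma C₂.map₁_arr {x y : Vertex X} (e : Edge x.pt y.pt) :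
    (C₂.map₁ φ).map (arr e) = edg (x := ⟨φ.app _ x.pt⟩) (y := ⟨φ.app _ y.pt⟩) (e.map φ) :=
  Paths.lift_toPath _ _

/-- The 2-cell of `C₂ Y` assigned to a generating 2-cell of `C₂ X`. -/
def C₂.map₂ : ∀ ⦃x y : OneCells X⦄ ⦃f g : x ⟶ y⦄, Triangle X f g →
    ((C₂.map₁ φ).map f ⟶ (C₂.map₁ φ).map g)
  | _, _, _, _, .tri h =>
      eqToHom (((C₂.map₁ φ).map_comp _ _).trans
        (congrArg₂ (· ≫ ·) (C₂.map₁_arr φ _) (C₂.map₁_arr φ _))) ≫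
      tri (x₀ := ⟨φ.app _ _⟩) (x₁ := ⟨φ.app _ _⟩) (x₂ := ⟨φ.app _ _⟩) (h.map φ) ≫
      eqToHom (C₂.map₁_arr φ _).symm

lemma C₂.map₂_rel ⦃x y : OneCells X⦄ ⦃f g : x ⟶ y⦄ (a b : PreCell (Triangle X) f g)
    (h : TetraRel X a b) :
    evalCell (C₂.map₁ φ) (C₂.map₂ φ) a = evalCell (C₂.map₁ φ) (C₂.map₂ φ) b := by
  cases h with
  | degen₀ e =>
    simp only [triCell, evalCell, C₂.map₂]
    rw [tri_degen₀ (h := (Edge.CompStruct.idComp e).map φ) (Edge.map_id _ _) rfl]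
    · exact eqToHom_trans₃ _ _ _
    · exact (ConcreteCategory.congr_hom (φ.naturality _) e.edge)
  | degen₁ e =>
    simp only [triCell, evalCell, C₂.map₂]
    rw [tri_degen₁ (h := (Edge.CompStruct.compId e).map φ) (Edge.map_id _ _) rfl]
    · exact eqToHom_trans₃ _ _ _
    · exact (ConcreteCategory.congr_hom (φ.naturality _) e.edge)
  | tetra h₀₁₂ h₀₂₃ h₁₂₃ h₀₁₃ τ d₃ d₁ d₀ d₂ =>
    have nat (i : Fin 4) (s) (hs : X.δ i τ = s) : Y.δ i (φ.app _ τ) = φ.app _ s := by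
      subst hs
      exact (ConcreteCategory.congr_hom (φ.naturality _) τ).symm
    exact tetra_transport (C₂.map₁ φ) (C₂.map₁_arr φ _) (C₂.map₁_arr φ _) (C₂.map₁_arr φ _)
      (C₂.map₁_arr φ _) (C₂.map₁_arr φ _) (C₂.map₁_arr φ _) _ _ _ _
      (tri_tetra (x₀ := ⟨φ.app _ _⟩) (x₁ := ⟨φ.app _ _⟩) (x₂ := ⟨φ.app _ _⟩)
        (x₃ := ⟨φ.app _ _⟩) (h₀₁₂.map φ) (h₀₂₃.map φ) (h₁₂₃.map φ) (h₀₁₃.map φ) (φ.app _ τ)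
        (nat _ _ d₃) (nat _ _ d₁) (nat _ _ d₀) (nat _ _ d₂))

/-- The 2-functor `C₂ φ` induced by a simplicial map `φ`. -/
def C₂.map : StrictPseudofunctor (C₂ X) (C₂ Y) :=
  lift (C₂.map₁ φ) (C₂.map₂ φ) (C₂.map₂_rel φ)

end SSet

/-! ## Ideals, distortions and skew immersions

2-categories are strict bicategories, 2-functors are strict pseudofunctors between them, and
normal lax functors are strictly unitary lax functors. -/

namespace TwoCat

/-- All 2-cells of a 2-category, with their 1- and 0-dimensional boundaries. -/
structure TwoCell (B : Type u) [Bicategory.{w, v} B] where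
  /-- The 0-dimensional domain. -/
  src : B
  /-- The 0-dimensional codomain. -/
  tgt : B
  /-- The 1-dimensional domain. -/
  dom : src ⟶ tgt
  /-- The 1-dimensional codomain. -/
  cod : src ⟶ tgt
  /-- The 2-cell. -/
  cell : dom ⟶ cod

section

variable {A : Type u} [Bicategory.{w, v} A] {B : Type u'} [Bicategory.{w', v'} B]

/-- The action of a 2-functor on 2-cells. -/
def onTwoCells (J : StrictPseudofunctor A B) (α : TwoCell A) : TwoCell B :=
  ⟨J.obj α.src, J.obj α.tgt, J.map α.dom, J.map α.cod, J.map₂ α.cell⟩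

/-- A 2-functor is an inclusion if it is injective on 0-cells, 1-cells and 2-cells, so that it
identifies `A` with a sub-2-category of `B`. -/
structure IsInclusion (J : StrictPseudofunctor A B) : Prop where
  obj_injective : Function.Injective J.obj
  map_injective (x y : A) : Function.Injective (J.map : (x ⟶ y) → (J.obj x ⟶ J.obj y))
  map₂_injective {x y : A} (f g : x ⟶ y) :
    Function.Injective (J.map₂ : (f ⟶ g) → (J.map f ⟶ J.map g))

/-- `A` is a left ideal of `B`: every 2-cell of `B` whose 0-dimensional codomain is in `A` is
in `A`. -/
def IsLeftIdeal (J : StrictPseudofunctor A B) : Prop :=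
  ∀ α : TwoCell B, α.tgt ∈ Set.range J.obj → α ∈ Set.range (onTwoCells J)

/-- `A` is a right ideal of `B`: every 2-cell of `B` whose 0-dimensional domain is in `A` is
in `A`. -/
def IsRightIdeal (J : StrictPseudofunctor A B) : Prop :=
  ∀ α : TwoCell B, α.src ∈ Set.range J.obj → α ∈ Set.range (onTwoCells J)

/-- A 2-functor, as a normal lax functor. -/
def lax (F : StrictPseudofunctor A B) : StrictlyUnitaryLaxFunctor A B :=
  F.toStrictlyUnitaryPseudofunctor.toStrictlyUnitaryLaxFunctor

/-- The 2-category generated by a single 1-cell `L ⟶ R`, with trivial 2-cells. -/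
abbrev Interval := LocallyDiscrete (Fin 2)

/-- The domain `L` of the generating 1-cell. -/
def Interval.L : Interval := ⟨0⟩

/-- The codomain `R` of the generating 1-cell. -/
def Interval.R : Interval := ⟨1⟩

variable (A) in
/-- The inclusion `A ≅ A × 1 ⟶ A × I` at an object of `I`. -/
def atEnd (c : Interval) : StrictlyUnitaryLaxFunctor A (A × Interval) :=
  (Bicategory.Prod.sectL A c).toStrictlyUnitaryLaxFunctor

/-- A distortion `F ⇝ G`: a normal lax functor `A × I ⟶ B` restricting to `F` at `L` and to `G`
at `R`. -/
structure Distortion (F G : StrictPseudofunctor A B) where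
  /-- The underlying normal lax functor. -/
  underlying : StrictlyUnitaryLaxFunctor (A × Interval) B
  atL : (atEnd A Interval.L).comp underlying = lax F
  atR : (atEnd A Interval.R).comp underlying = lax G

/-- The normal lax functor underlying the identity distortion of a 2-functor `F`: the composite
of the projection with `F`. -/
def idDistortion (F : StrictPseudofunctor A B) : StrictlyUnitaryLaxFunctor (A × Interval) B :=
  (lax (Bicategory.Prod.fst A Interval)).comp (lax F)

/-- The 2-functor `J × I`. -/
def timesInterval (J : StrictPseudofunctor A B) :
    StrictPseudofunctor (A × Interval) (B × Interval) :=
  .mk'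
    { obj X := (J.obj X.1, X.2)
      map f := (J.map f.1, f.2)
      map₂ η := (J.map₂ η.1, η.2)
      map_id X := Prod.ext (J.map_id X.1) rfl
      map_comp f g := Prod.ext (J.map_comp f.1 g.1) rfl
      map₂_id _ := Prod.ext (J.map₂_id _) rfl
      map₂_comp _ _ := Prod.ext (J.map₂_comp _ _) rfl
      map₂_whisker_left f _ _ η := by
        refine Prod.ext ?_ (Subsingleton.elim _ _)
        simp [J.mapComp_eq_eqToIso]
      map₂_whisker_right η f := by
        refine Prod.ext ?_ (Subsingleton.elim _ _)
        simp [J.mapComp_eq_eqToIso]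
      map₂_left_unitor f := by
        refine Prod.ext ?_ (Subsingleton.elim _ _)
        simp [J.mapComp_eq_eqToIso, J.mapId_eq_eqToIso]
      map₂_right_unitor f := by
        refine Prod.ext ?_ (Subsingleton.elim _ _)
        simp [J.mapComp_eq_eqToIso, J.mapId_eq_eqToIso]
      map₂_associator f g h := by
        refine Prod.ext ?_ (Subsingleton.elim _ _)
        simp [J.mapComp_eq_eqToIso] }

/-- An inclusion `J : A ⟶ B` of 2-categories is a skew immersion if `A` is a left ideal of `B` and
there is a right ideal `W` of `B` (with inclusion `K`) containing `A`, such that the corestriction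
`J' : A ⟶ W` has a retraction `R` and there is a distortion `d : J' ∘ R ⇝ id_W` which is the
identity distortion when whiskered with `J'`. -/
structure IsSkewImmersion [Strict A] [Strict B] (J : StrictPseudofunctor A B) : Prop where
  isInclusion : IsInclusion J
  isLeftIdeal : IsLeftIdeal J
  exists_rightIdeal :
    ∃ (W : Type u') (_ : Bicategory.{w', v'} W) (_ : Strict W) (K : StrictPseudofunctor W B)
      (J' : StrictPseudofunctor A W) (R : StrictPseudofunctor W A)
      (d : Distortion (R.comp J') (StrictPseudofunctor.id W)),
      IsInclusion K ∧ IsRightIdeal K ∧ J'.comp K = J ∧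
      J'.comp R = StrictPseudofunctor.id A ∧
      (lax (timesInterval J')).comp d.underlying = idDistortion J'

end

end TwoCat

/-! ### Finite chains in a partial order -/

namespace TwoCat

/-! The horn plays no special role: the argument applies to any inclusion `X ⊆ Y` of simplicial
subsets of the nerve of a partial order `Q`, and `Δ[n]` is itself such a nerve. The subdivision of
`X` is the nerve of the poset of those chains of `Q` that are vertex sets of simplices of `X`
(`mono_sdToNerve`, `mem_range_sdToNerve`). Hence the double subdivision is the nerve of the poset
`S` of nonempty finite chains of such chains, sitting inside the analogous poset `S'` for `Y`.

For the nerve of a poset, `C₂` is explicit: objects are points, 1-cells are finite chains composed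
by union, and there is exactly one 2-cell from a chain to each subchain with the same ends, and no
other (`NerveModel.chainSupport`). The delicate point is uniqueness of 2-cells. An edge is terminal
in its hom-category (`comp_cone`), and a 2-cell into a composite splits along that composite
(`hom_split`), so uniqueness follows by induction on the target. From then on all equations between
2-cells are automatic, and 2-functors and normal lax functors are just assignments of chains.

What remains is order theory (`ChainSupport.isSkewImmersion`). The set `S` is closed downwards in
`S'`, whence the left ideal. Let `V` consist of the members of `S'` at least one of whose terms
comes from `X`; it is closed upwards, whence the right ideal. Discarding from `G ∈ V` the terms not
coming from `X` gives a monotone `r : V → S` with `r ≤ id`, fixing `S`. Here the second subdivision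
is essential: the part of a single simplex lying in `X` need not be a simplex, but the part of a
chain of simplices is again a chain.

The retraction applies `r` to chains pointwise. Over `L ⟶ R` the distortion sends a chain `c` from
`a` to `b` to `{r a} ∪ (c ∩ S) ∪ {b}`. The middle term makes this equal to `c` when `c ⊆ S`, as the
condition on `εJ` demands, and it is compatible with lax composition because `r` fixes `S`. -/

/-- A finite chain of a partial order with least element `a` and greatest element `b`. -/
structure IsChainBetween {P : Type*} [PartialOrder P] (a b : P) (c : Set P) : Prop where
  left_mem : a ∈ c
  right_mem : b ∈ c
  left_le : ∀ z ∈ c, a ≤ z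
  le_right : ∀ z ∈ c, z ≤ b
  total : ∀ x ∈ c, ∀ y ∈ c, x ≤ y ∨ y ≤ x
  finite : c.Finite

namespace IsChainBetween

variable {P : Type*} [PartialOrder P] {a b d : P} {c c' : Set P}

lemma le (h : IsChainBetween a b c) : a ≤ b := h.left_le _ h.right_mem

lemma singleton (a : P) : IsChainBetween a a {a} where
  left_mem := rfl
  right_mem := rfl
  left_le := by simp
  le_right := by simp
  total := by simp
  finite := by simp

lemma pair (h : a ≤ b) : IsChainBetween a b {a, b} where
  left_mem := by simp
  right_mem := by simp
  left_le := by simp [h]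
  le_right := by simp [h]
  total := by rintro x (rfl | rfl) y (rfl | rfl) <;> simp [h]
  finite := by simp

lemma union (h : IsChainBetween a b c) (h' : IsChainBetween b d c') :
    IsChainBetween a d (c ∪ c') where
  left_mem := .inl h.left_mem
  right_mem := .inr h'.right_mem
  left_le := by
    rintro z (hz | hz)
    exacts [h.left_le _ hz, h.le.trans (h'.left_le _ hz)]
  le_right := by
    rintro z (hz | hz)
    exacts [(h.le_right _ hz).trans h'.le, h'.le_right _ hz]
  total := by
    rintro x (hx | hx) y (hy | hy)
    · exact h.total _ hx _ hy
    · exact .inl ((h.le_right _ hx).trans (h'.left_le _ hy))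
    · exact .inr ((h.le_right _ hy).trans (h'.left_le _ hx))
    · exact h'.total _ hx _ hy
  finite := h.finite.union h'.finite

lemma image {r : P → P} (h : IsChainBetween a b c)
    (hr : ∀ x ∈ c, ∀ y ∈ c, x ≤ y → r x ≤ r y) : IsChainBetween (r a) (r b) (r '' c) where
  left_mem := ⟨a, h.left_mem, rfl⟩
  right_mem := ⟨b, h.right_mem, rfl⟩
  left_le := by
    rintro _ ⟨z, hz, rfl⟩
    exact hr _ h.left_mem _ hz (h.left_le _ hz)
  le_right := by
    rintro _ ⟨z, hz, rfl⟩
    exact hr _ hz _ h.right_mem (h.le_right _ hz)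
  total := by
    rintro _ ⟨x, hx, rfl⟩ _ ⟨y, hy, rfl⟩
    exact (h.total _ hx _ hy).imp (hr _ hx _ hy) (hr _ hy _ hx)
  finite := h.finite.image r

lemma eq_singleton (h : IsChainBetween a a c) : c = {a} :=
  Set.eq_singleton_iff_unique_mem.2
    ⟨h.left_mem, fun z hz => le_antisymm (h.le_right z hz) (h.left_le z hz)⟩

end IsChainBetween

/-! ### 2-categories of finite chains, and functors into them -/

/-- The structure exhibiting a 2-category as the full sub-2-category on a set `S` of points of the
2-category whose objects are the points of a partial order `P`, whose 1-cells are finite chains,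
and which has a unique 2-cell from a chain to each coarser chain. -/
structure ChainSupport (B : Type u) [Bicategory.{w, v} B] {P : Type u'} [PartialOrder P]
    (S : Set P) where
  /-- The point corresponding to an object. -/
  pt : B → P
  pt_injective : Function.Injective pt
  range_pt : Set.range pt = S
  /-- The finite chain corresponding to a 1-cell. -/
  supp : ∀ {x y : B}, (x ⟶ y) → Set P
  isChainBetween {x y : B} (f : x ⟶ y) : IsChainBetween (pt x) (pt y) (supp f)
  supp_subset {x y : B} (f : x ⟶ y) : supp f ⊆ S
  supp_id (x : B) : supp (𝟙 x) = {pt x}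
  supp_comp {x y z : B} (f : x ⟶ y) (g : y ⟶ z) : supp (f ≫ g) = supp f ∪ supp g
  supp_injective {x y : B} {f g : x ⟶ y} (h : supp f = supp g) : f = g
  exists_supp {x y : B} {c : Set P} (hc : IsChainBetween (pt x) (pt y) c) (hS : c ⊆ S) :
    ∃ f : x ⟶ y, supp f = c
  subsingleton_hom {x y : B} (f g : x ⟶ y) : Subsingleton (f ⟶ g)
  nonempty_hom_iff {x y : B} (f g : x ⟶ y) : Nonempty (f ⟶ g) ↔ supp g ⊆ supp f

namespace ChainSupport

variable {A : Type u} [Bicategory.{w, v} A] {B : Type u'} [Bicategory.{w', v'} B]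
  {P : Type*} [PartialOrder P] {S S' V : Set P}

lemma pt_mem (cB : ChainSupport B S) (x : B) : cB.pt x ∈ S := by
  simpa only [cB.range_pt] using Set.mem_range_self (f := cB.pt) x

lemma exists_pt (cB : ChainSupport B S) {p : P} (hp : p ∈ S) : ∃ x, cB.pt x = p := by
  rwa [← cB.range_pt] at hp

/-- Chains are subsets of the fixed poset `P`, so those of `F` and `G` can be compared before the
object maps are identified, without transport. Nothing need be checked on 2-cells, which are unique.
-/
lemma prelaxFunctor_ext (cB : ChainSupport B S) {F G : PrelaxFunctor A B}
    (hobj : ∀ x, F.obj x = G.obj x)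
    (hmap : ∀ {x y : A} (f : x ⟶ y), cB.supp (F.map f) = cB.supp (G.map f)) : F = G := by
  have := @cB.subsingleton_hom
  obtain ⟨⟨⟨Fo, Fm⟩, F₂⟩, _, _⟩ := F
  obtain ⟨⟨⟨Go, Gm⟩, G₂⟩, _, _⟩ := G
  obtain rfl : Fo = Go := funext hobj
  obtain rfl : @Fm = @Gm := by
    funext x y f
    exact cB.supp_injective (hmap f)
  congr
  funext x y f g η
  exact Subsingleton.elim _ _

lemma strictPseudofunctor_ext (cB : ChainSupport B S) {F G : StrictPseudofunctor A B}
    (hobj : ∀ x, F.obj x = G.obj x)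
    (hmap : ∀ {x y : A} (f : x ⟶ y), cB.supp (F.map f) = cB.supp (G.map f)) : F = G := by
  have key : F.toPrelaxFunctor = G.toPrelaxFunctor := cB.prelaxFunctor_ext hobj hmap
  have := @cB.subsingleton_hom
  obtain ⟨⟨⟨F, Fi, Fc, _, _, _, _, _⟩, _, _⟩, _, _⟩ := F
  obtain ⟨⟨⟨G, Gi, Gc, _, _, _, _, _⟩, _, _⟩, _, _⟩ := G
  obtain rfl : F = G := key
  obtain rfl : @Fi = @Gi := by
    funext x
    exact Iso.ext (Subsingleton.elim _ _)
  obtain rfl : @Fc = @Gc := by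
    funext x y z f g
    exact Iso.ext (Subsingleton.elim _ _)
  rfl

lemma laxFunctor_ext (cB : ChainSupport B S) {F G : StrictlyUnitaryLaxFunctor A B}
    (hobj : ∀ x, F.obj x = G.obj x)
    (hmap : ∀ {x y : A} (f : x ⟶ y), cB.supp (F.map f) = cB.supp (G.map f)) : F = G := by
  have key : F.toPrelaxFunctor = G.toPrelaxFunctor := cB.prelaxFunctor_ext hobj hmap
  have := @cB.subsingleton_hom
  obtain ⟨⟨F, Fi, Fc, _, _, _, _, _⟩, _, _⟩ := F
  obtain ⟨⟨G, Gi, Gc, _, _, _, _, _⟩, _, _⟩ := G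
  obtain rfl : F = G := key
  obtain rfl : @Fi = @Gi := by
    funext x
    exact Subsingleton.elim _ _
  obtain rfl : @Fc = @Gc := by
    funext x y z f g
    exact Subsingleton.elim _ _
  rfl

section construction

variable (cB : ChainSupport B S) (obj : A → B) (σ : ∀ {x y : A}, (x ⟶ y) → Set P)
  (hσ : ∀ {x y : A} (f : x ⟶ y), IsChainBetween (cB.pt (obj x)) (cB.pt (obj y)) (σ f))
  (hS : ∀ {x y : A} (f : x ⟶ y), σ f ⊆ S)
  (h₂ : ∀ {x y : A} {f g : x ⟶ y}, (f ⟶ g) → σ g ⊆ σ f)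

/-- The assignment on 1-cells determined by an assignment of chains. -/
noncomputable def mapOfSupp {x y : A} (f : x ⟶ y) : obj x ⟶ obj y :=
  (cB.exists_supp (hσ f) (hS f)).choose

lemma supp_mapOfSupp {x y : A} (f : x ⟶ y) : cB.supp (cB.mapOfSupp obj σ hσ hS f) = σ f :=
  (cB.exists_supp (hσ f) (hS f)).choose_spec

/-- The assignment on 2-cells determined by an assignment of chains to 1-cells. -/
noncomputable def map₂OfSupp {x y : A} {f g : x ⟶ y} (η : f ⟶ g) :
    cB.mapOfSupp obj σ hσ hS f ⟶ cB.mapOfSupp obj σ hσ hS g :=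
  ((cB.nonempty_hom_iff _ _).2 (by
    rw [supp_mapOfSupp, supp_mapOfSupp]
    exact h₂ η)).some

/-- The normal lax functor determined by an assignment of chains to 1-cells. -/
noncomputable def laxFunctorOfSupp (hid : ∀ x, σ (𝟙 x) = {cB.pt (obj x)})
    (hcomp : ∀ {x y z : A} (f : x ⟶ y) (g : y ⟶ z), σ (f ≫ g) ⊆ σ f ∪ σ g) :
    StrictlyUnitaryLaxFunctor A B :=
  .mk'
    { obj := obj
      map := cB.mapOfSupp obj σ hσ hS
      map_id x := cB.supp_injective (by
        rw [supp_mapOfSupp, hid, cB.supp_id])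
      map₂ := cB.map₂OfSupp obj σ hσ hS h₂
      -- 2-cells go from a chain to its subchains, so the lax constraint needs only an inclusion;
      -- for a 2-functor it becomes an equality.
      mapComp f g := ((cB.nonempty_hom_iff _ _).2 (by
        rw [cB.supp_comp, supp_mapOfSupp, supp_mapOfSupp, supp_mapOfSupp]
        exact hcomp f g)).some
      map₂_id _ := (cB.subsingleton_hom _ _).elim _ _
      map₂_comp _ _ := (cB.subsingleton_hom _ _).elim _ _
      mapComp_naturality_left _ _ := (cB.subsingleton_hom _ _).elim _ _
      mapComp_naturality_right _ _ _ _ := (cB.subsingleton_hom _ _).elim _ _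
      map₂_leftUnitor _ := (cB.subsingleton_hom _ _).elim _ _
      map₂_rightUnitor _ := (cB.subsingleton_hom _ _).elim _ _
      map₂_associator _ _ _ := (cB.subsingleton_hom _ _).elim _ _ }

lemma supp_laxFunctorOfSupp_map (hid : ∀ x, σ (𝟙 x) = {cB.pt (obj x)})
    (hcomp : ∀ {x y z : A} (f : x ⟶ y) (g : y ⟶ z), σ (f ≫ g) ⊆ σ f ∪ σ g)
    {x y : A} (f : x ⟶ y) :
    cB.supp ((cB.laxFunctorOfSupp obj σ hσ hS h₂ hid hcomp).map f) = σ f :=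
  cB.supp_mapOfSupp obj σ hσ hS f

/-- The 2-functor determined by an assignment of chains to 1-cells. -/
noncomputable def strictPseudofunctorOfSupp (hid : ∀ x, σ (𝟙 x) = {cB.pt (obj x)})
    (hcomp : ∀ {x y z : A} (f : x ⟶ y) (g : y ⟶ z), σ (f ≫ g) = σ f ∪ σ g) :
    StrictPseudofunctor A B :=
  .mk'
    { obj := obj
      map := cB.mapOfSupp obj σ hσ hS
      map₂ := cB.map₂OfSupp obj σ hσ hS h₂
      map₂_id _ := (cB.subsingleton_hom _ _).elim _ _
      map₂_comp _ _ := (cB.subsingleton_hom _ _).elim _ _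
      map_id x := cB.supp_injective (by
        rw [supp_mapOfSupp, hid, cB.supp_id])
      map_comp f g := cB.supp_injective (by
        rw [supp_mapOfSupp, cB.supp_comp, supp_mapOfSupp, supp_mapOfSupp, hcomp])
      map₂_whisker_left _ _ _ _ := (cB.subsingleton_hom _ _).elim _ _
      map₂_whisker_right _ _ := (cB.subsingleton_hom _ _).elim _ _
      map₂_left_unitor _ := (cB.subsingleton_hom _ _).elim _ _
      map₂_right_unitor _ := (cB.subsingleton_hom _ _).elim _ _
      map₂_associator _ _ _ := (cB.subsingleton_hom _ _).elim _ _ }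

lemma supp_strictPseudofunctorOfSupp_map (hid : ∀ x, σ (𝟙 x) = {cB.pt (obj x)})
    (hcomp : ∀ {x y z : A} (f : x ⟶ y) (g : y ⟶ z), σ (f ≫ g) = σ f ∪ σ g)
    {x y : A} (f : x ⟶ y) :
    cB.supp ((cB.strictPseudofunctorOfSupp obj σ hσ hS h₂ hid hcomp).map f) = σ f :=
  cB.supp_mapOfSupp obj σ hσ hS f

end construction

/-- The full sub-2-category on a set of points which is upwards closed. -/
def full (cB : ChainSupport B S) (V : Set P) (hV : V ⊆ S)
    (hV' : ∀ p ∈ V, ∀ q ∈ S, p ≤ q → q ∈ V) :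
    ChainSupport (InducedBicategory B (Subtype.val : {x : B // cB.pt x ∈ V} → B)) V where
  pt x := cB.pt x.1
  pt_injective _ _ h := Subtype.ext (cB.pt_injective h)
  range_pt := by
    ext p
    constructor
    · rintro ⟨x, rfl⟩
      exact x.2
    · intro hp
      obtain ⟨x, rfl⟩ := cB.exists_pt (hV hp)
      exact ⟨⟨x, hp⟩, rfl⟩
  supp f := cB.supp f.hom
  isChainBetween f := cB.isChainBetween f.hom
  -- Upward closure enters here: a chain starting in `V` never leaves it.
  supp_subset {x _} f _ hp :=
    hV' _ x.2 _ (cB.supp_subset _ hp) ((cB.isChainBetween _).left_le _ hp)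
  supp_id x := cB.supp_id _
  supp_comp f g := cB.supp_comp _ _
  supp_injective h := InducedBicategory.hom_ext (cB.supp_injective h)
  exists_supp hc hS := by
    obtain ⟨f, hf⟩ := cB.exists_supp hc (hS.trans hV)
    exact ⟨InducedBicategory.mkHom f, hf⟩
  subsingleton_hom f g := ⟨fun a b =>
    InducedBicategory.hom₂_ext ((cB.subsingleton_hom f.hom g.hom).elim _ _)⟩
  nonempty_hom_iff f g := by
    rw [← cB.nonempty_hom_iff]
    exact ⟨fun ⟨a⟩ => ⟨a.hom⟩, fun ⟨a⟩ => ⟨⟨a⟩⟩⟩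


lemma isInclusion (cA : ChainSupport A S) (cB : ChainSupport B S') (J : StrictPseudofunctor A B)
    (hJ : ∀ x, cB.pt (J.obj x) = cA.pt x)
    (hJ' : ∀ {x y : A} (f : x ⟶ y), cB.supp (J.map f) = cA.supp f) : IsInclusion J where
  obj_injective x y h := cA.pt_injective (by rw [← hJ, h, hJ])
  map_injective x y f g h := cA.supp_injective (by rw [← hJ', h, hJ'])
  map₂_injective f g := fun _ _ _ => (cA.subsingleton_hom f g).elim _ _

/-- Only the 1-dimensional domain has to be tested: the codomain is a subchain of it, and `A`
contains every chain in `S` and every 2-cell between such chains. Both ideal conditions reduce to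
this. -/
lemma mem_range_onTwoCells (cA : ChainSupport A S) (cB : ChainSupport B S')
    (J : StrictPseudofunctor A B) (hJ : ∀ x, cB.pt (J.obj x) = cA.pt x)
    (hJ' : ∀ {x y : A} (f : x ⟶ y), cB.supp (J.map f) = cA.supp f)
    (α : TwoCell B) (h : cB.supp α.dom ⊆ S) : α ∈ Set.range (onTwoCells J) := by
  obtain ⟨x, y, f, g, η⟩ := α
  dsimp only at h
  obtain ⟨x, rfl⟩ : x ∈ Set.range J.obj := by
    obtain ⟨x', hx'⟩ := cA.exists_pt (h (cB.isChainBetween f).left_mem)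
    exact ⟨x', cB.pt_injective (by rw [hJ, hx'])⟩
  obtain ⟨y, rfl⟩ : y ∈ Set.range J.obj := by
    obtain ⟨y', hy'⟩ := cA.exists_pt (h (cB.isChainBetween f).right_mem)
    exact ⟨y', cB.pt_injective (by rw [hJ, hy'])⟩
  have key (k : J.obj x ⟶ J.obj y) (hk : cB.supp k ⊆ S) : ∃ k', J.map k' = k := by
    have hc := cB.isChainBetween k
    rw [hJ, hJ] at hc
    obtain ⟨k', hk'⟩ := cA.exists_supp hc hk
    exact ⟨k', cB.supp_injective (by rw [hJ', hk'])⟩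
  have hgf := (cB.nonempty_hom_iff f g).1 ⟨η⟩
  obtain ⟨f, rfl⟩ := key f h
  obtain ⟨g, rfl⟩ := key g (hgf.trans h)
  rw [hJ', hJ', ← cA.nonempty_hom_iff] at hgf
  obtain ⟨θ⟩ := hgf
  refine ⟨⟨x, y, f, g, θ⟩, ?_⟩
  obtain rfl : J.map₂ θ = η := (cB.subsingleton_hom _ _).elim _ _
  rfl

end ChainSupport

/-! ### The chains defining the distortion -/

section

variable {P : Type*} (S : Set P) (r : P → P)

/-- The point assigned by a distortion to a point `p` and an object of the interval. -/
def distPt (i : Fin 2) (p : P) : P := if i = 0 then r p else p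

/-- The chain assigned by a distortion to a chain `c` from `a` to `b` and a 1-cell of the
interval. -/
def distSupp (i j : Fin 2) (a b : P) (c : Set P) : Set P :=
  -- The pair `i = 1`, `j = 0` gets a default value: the interval has no 1-cell from `R` to `L`.
  if i = 0 then (if j = 0 then r '' c else insert (r a) (insert b (c ∩ S))) else c

variable {S r} {a b : P} {c c' : Set P}

lemma distSupp_self (i : Fin 2) (a : P) : distSupp S r i i a a {a} = {distPt r i a} := by
  fin_cases i <;> simp [distSupp, distPt]

lemma distSupp_mono (i j : Fin 2) (h : c' ⊆ c) :
    distSupp S r i j a b c' ⊆ distSupp S r i j a b c := by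
  fin_cases i <;> fin_cases j <;> simp [distSupp]
  · exact Set.image_subset_iff.1 (Set.image_mono h)
  · exact Set.insert_subset_insert (Set.insert_subset_insert (Set.inter_subset_inter_left _ h))
  · exact h
  · exact h

end

section

variable {P : Type*} [PartialOrder P] {S V : Set P} {r : P → P} {a b d : P} {c c' : Set P}

/-- This is the source of `εJ = id`: for a chain in `S` all cases of the formula collapse to `c`. -/
lemma distSupp_eq (hr_self : ∀ p ∈ S, r p = p)
    (i j : Fin 2) (hij : i ≤ j) (hc : IsChainBetween a b c) (hcS : c ⊆ S) :
    distSupp S r i j a b c = c := by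
  have himage : r '' c = c := by
    ext z
    constructor
    · rintro ⟨z, hz, rfl⟩
      rwa [hr_self z (hcS hz)]
    · exact fun hz => ⟨z, hz, hr_self z (hcS hz)⟩
  have h₂ : insert (r a) (insert b (c ∩ S)) = c := by
    rw [hr_self a (hcS hc.left_mem), Set.inter_eq_left.2 hcS, Set.insert_eq_of_mem hc.right_mem,
      Set.insert_eq_of_mem hc.left_mem]
  fin_cases i <;> fin_cases j <;> simp_all [distSupp]

lemma distSupp_subset (hr : ∀ p ∈ V, r p ∈ S)
    (hSV : S ⊆ V) (i j : Fin 2) (hc : IsChainBetween a b c) (hcV : c ⊆ V) :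
    distSupp S r i j a b c ⊆ V := by
  have h₀ : ∀ z ∈ c, r z ∈ V := fun z hz => hSV (hr z (hcV hz))
  fin_cases i <;> fin_cases j <;> simp [distSupp, hcV, Set.insert_subset_iff, h₀ _ hc.left_mem,
    hcV hc.right_mem]
  · exact h₀
  · exact Set.inter_subset_left.trans hcV

/-- This gives the lax constraint. If the first factor lies over `L`, a point of `c ∩ S` survives in
`r '' c` because `r` fixes it; if the second lies over `R`, all of `c'` is kept. With `r '' c` in
place of `c ∩ S` the latter case would fail, since `r z` for `z ∈ c'` need not lie in `c'`. -/
lemma distSupp_union (hr_self : ∀ p ∈ S, r p = p)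
    (i j k : Fin 2) (hij : i ≤ j) (hjk : j ≤ k) (hc : IsChainBetween a b c)
    (hc' : IsChainBetween b d c') :
    distSupp S r i k a d (c ∪ c') ⊆ distSupp S r i j a b c ∪ distSupp S r j k b d c' := by
  fin_cases i <;> fin_cases j <;> fin_cases k <;> simp [distSupp] at hij hjk ⊢
  · exact ⟨fun z hz => .inl ⟨z, hz, rfl⟩, fun z hz => .inr ⟨z, hz, rfl⟩⟩
  · rintro z (rfl | rfl | ⟨hz | hz, hzS⟩)
    · exact .inr (.inr (.inl ⟨_, hc.left_mem, rfl⟩))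
    · simp
    · exact .inr (.inr (.inl ⟨z, hz, hr_self z hzS⟩))
    · simp [hz, hzS]
  · rintro z (rfl | rfl | ⟨hz | hz, hzS⟩)
    · simp
    · exact .inr hc'.right_mem
    · simp [hz, hzS]
    · exact .inr hz

/-- Over `L ⟶ R` only `r a ≤ a` is needed: it puts `r a` below all of `c`, while `b` is already
above all of `c`. -/
lemma isChainBetween_distSupp (hr_mono : ∀ p ∈ V, ∀ q ∈ V, p ≤ q → r p ≤ r q)
    (hr_le : ∀ p ∈ V, r p ≤ p) (i j : Fin 2) (hij : i ≤ j)
    (hc : IsChainBetween a b c) (hcV : c ⊆ V) :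
    IsChainBetween (distPt r i a) (distPt r j b) (distSupp S r i j a b c) := by
  have h₁ : IsChainBetween (r a) (r b) (r '' c) :=
    hc.image fun x hx y hy hxy => hr_mono _ (hcV hx) _ (hcV hy) hxy
  have hab : r a ≤ b := (hr_le a (hcV hc.left_mem)).trans hc.le
  have h₂ : IsChainBetween (r a) b (insert (r a) (insert b (c ∩ S))) := by
    have hl : ∀ z ∈ c, r a ≤ z := fun z hz =>
      (hr_le a (hcV hc.left_mem)).trans (hc.left_le z hz)
    refine ⟨by simp, by simp, ?_, ?_, ?_, ?_⟩
    · rintro z (rfl | rfl | ⟨hz, -⟩)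
      exacts [le_rfl, hab, hl z hz]
    · rintro z (rfl | rfl | ⟨hz, -⟩)
      exacts [hab, le_rfl, hc.le_right z hz]
    · rintro z (rfl | rfl | ⟨hz, -⟩) y (rfl | rfl | ⟨hy, -⟩)
      · exact .inl le_rfl
      · exact .inl hab
      · exact .inl (hl y hy)
      · exact .inr hab
      · exact .inl le_rfl
      · exact .inr (hc.le_right y hy)
      · exact .inr (hl z hz)
      · exact .inl (hc.le_right z hz)
      · exact hc.total z hz y hy
    · exact ((hc.finite.subset Set.inter_subset_left).insert b).insert (r a)
  fin_cases i <;> fin_cases j <;> simp_all [distSupp, distPt]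

end

/-! ### The order-theoretic criterion for skew immersions -/

namespace ChainSupport

variable {A : Type u} [Bicategory.{w, v} A] {B : Type u'} [Bicategory.{w', v'} B]
  {P : Type*} [PartialOrder P] {S S' V : Set P}

/-- A downwards closed inclusion of 2-categories of chains which is a deformation retract of its
upwards closure is a skew immersion. -/
theorem isSkewImmersion [Strict A] [Strict B] (cA : ChainSupport A S) (cB : ChainSupport B S')
    (J : StrictPseudofunctor A B) (hJ : ∀ x, cB.pt (J.obj x) = cA.pt x)
    (hJ' : ∀ {x y : A} (f : x ⟶ y), cB.supp (J.map f) = cA.supp f)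
    (hS : ∀ p ∈ S', ∀ q ∈ S, p ≤ q → p ∈ S)
    (hVS' : V ⊆ S') (hV : ∀ p ∈ V, ∀ q ∈ S', p ≤ q → q ∈ V) (hSV : S ⊆ V) (r : P → P)
    (hr : ∀ p ∈ V, r p ∈ S) (hr_mono : ∀ p ∈ V, ∀ q ∈ V, p ≤ q → r p ≤ r q)
    (hr_le : ∀ p ∈ V, r p ≤ p) (hr_self : ∀ p ∈ S, r p = p) : IsSkewImmersion J where
  isInclusion := isInclusion cA cB J hJ hJ'
  isLeftIdeal := by
    rintro ⟨x, y, f, g, η⟩ ⟨a, rfl⟩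
    -- A chain ending in `S` lies in `S` by downward closure.
    refine mem_range_onTwoCells cA cB J hJ hJ' _ fun z hz => ?_
    refine hS _ (cB.supp_subset _ hz) _ (cA.pt_mem a) ?_
    rw [← hJ]
    exact (cB.isChainBetween f).le_right _ hz
  exists_rightIdeal := by
    let W := InducedBicategory B (Subtype.val : {x : B // cB.pt x ∈ V} → B)
    let cW : ChainSupport W V := cB.full V hVS' hV
    let J' : StrictPseudofunctor A W := cW.strictPseudofunctorOfSupp
      (fun x => ⟨J.obj x, by rw [hJ]; exact hSV (cA.pt_mem x)⟩) (fun f => cA.supp f)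
      (fun {x y} f => by
        have := cA.isChainBetween f
        rwa [← hJ, ← hJ] at this)
      (fun f => (cA.supp_subset f).trans hSV)
      (fun η => (cA.nonempty_hom_iff _ _).1 ⟨η⟩)
      (fun x => (cA.supp_id x).trans (congrArg _ (hJ x).symm)) (fun f g => cA.supp_comp f g)
    have hJ'pt (x : A) : cW.pt (J'.obj x) = cA.pt x := hJ x
    have hJ'supp {x y : A} (f : x ⟶ y) : cW.supp (J'.map f) = cA.supp f :=
      cW.supp_strictPseudofunctorOfSupp_map ..
    -- On objects, `ρ` is `r` read through the bijection between objects and points.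
    choose ρ hρ using fun w : W => cA.exists_pt (hr _ (cW.pt_mem w))
    let R : StrictPseudofunctor W A := cA.strictPseudofunctorOfSupp ρ
      (fun f => r '' cW.supp f)
      (fun f => by
        rw [hρ, hρ]
        exact (cW.isChainBetween f).image fun x hx y hy =>
          hr_mono _ (cW.supp_subset _ hx) _ (cW.supp_subset _ hy))
      (fun f => by
        rintro _ ⟨z, hz, rfl⟩
        exact hr _ (cW.supp_subset _ hz))
      (fun η => Set.image_mono ((cW.nonempty_hom_iff _ _).1 ⟨η⟩))
      (fun x => by rw [cW.supp_id, hρ, Set.image_singleton])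
      (fun f g => by rw [cW.supp_comp, Set.image_union])
    have hRsupp {x y : W} (f : x ⟶ y) : cA.supp (R.map f) = r '' cW.supp f :=
      cA.supp_strictPseudofunctorOfSupp_map ..
    -- On objects the distortion is `r` over `L` and the identity over `R`.
    choose ω hω using fun w : W × Interval => cW.exists_pt (p := distPt r w.2.as (cW.pt w.1)) (by
      unfold distPt
      split_ifs
      exacts [hSV (hr _ (cW.pt_mem _)), cW.pt_mem _])
    have hle {x y : Interval} (f : x ⟶ y) : x.as ≤ y.as := leOfHom f.as
    let E : StrictlyUnitaryLaxFunctor (W × Interval) W := cW.laxFunctorOfSupp ω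
      (fun {x y} f => distSupp S r x.2.as y.2.as (cW.pt x.1) (cW.pt y.1) (cW.supp f.1))
      (fun f => by
        rw [hω, hω]
        exact isChainBetween_distSupp hr_mono hr_le _ _ (hle f.2)
          (cW.isChainBetween f.1) (cW.supp_subset f.1))
      (fun f => distSupp_subset hr hSV _ _ (cW.isChainBetween f.1) (cW.supp_subset f.1))
      (fun η => distSupp_mono _ _ ((cW.nonempty_hom_iff _ _).1 ⟨η.1⟩))
      (fun x => by
        rw [hω]
        exact (congrArg _ (cW.supp_id x.1)).trans (distSupp_self _ _))
      (fun f g => by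
        refine (Eq.subset (congrArg _ (cW.supp_comp f.1 g.1))).trans ?_
        exact distSupp_union hr_self _ _ _ (hle f.2) (hle g.2) (cW.isChainBetween _)
          (cW.isChainBetween _))
    have hEsupp {x y : W × Interval} (f : x ⟶ y) : cW.supp (E.map f) =
        distSupp S r x.2.as y.2.as (cW.pt x.1) (cW.pt y.1) (cW.supp f.1) :=
      cW.supp_laxFunctorOfSupp_map ..
    have hRJ : J'.comp R = StrictPseudofunctor.id A := by
      refine cA.strictPseudofunctor_ext (fun x => ?_) (fun {x y} f => ?_)
      · refine cA.pt_injective ((hρ _).trans ?_)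
        rw [hJ'pt, hr_self _ (cA.pt_mem x)]
        rfl
      · refine (hRsupp _).trans ?_
        rw [hJ'supp]
        refine (Set.image_congr fun z hz => hr_self z (cA.supp_subset f hz)).trans ?_
        exact Set.image_id' _
    refine ⟨W, inferInstance, inferInstance, InducedBicategory.forget, J', R,
      ⟨E, ?_, ?_⟩, ?_, ?_, ?_, hRJ, ?_⟩
    · refine cW.laxFunctor_ext (fun x => cW.pt_injective ?_) (fun {x y} f => ?_)
      · refine (hω _).trans ?_
        refine Eq.trans ?_ (hJ'pt _).symm
        exact (hρ x).symm
      · refine (hEsupp _).trans ?_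
        refine Eq.trans ?_ (hJ'supp _).symm
        exact (hRsupp f).symm
    · refine cW.laxFunctor_ext (fun x => cW.pt_injective ?_) (fun {x y} f => ?_)
      · exact hω _
      · exact hEsupp _
    · exact cW.isInclusion cB _ (fun _ => rfl) (fun _ => rfl)
    · rintro ⟨x, y, f, g, η⟩ ⟨a, rfl⟩
      exact mem_range_onTwoCells cW cB _ (fun _ => rfl) (fun _ => rfl) _ fun z hz =>
        hV _ (cW.pt_mem a) _ (cB.supp_subset _ hz) ((cB.isChainBetween f).left_le _ hz)
    · refine cB.strictPseudofunctor_ext (fun x => rfl) (fun {x y} f => ?_)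
      exact (hJ'supp f).trans (hJ' f).symm
    · refine cW.laxFunctor_ext (fun x => cW.pt_injective ?_) (fun {x y} f => ?_)
      · refine (hω _).trans ?_
        refine Eq.trans ?_ (hJ'pt _).symm
        refine (congrArg _ (hJ'pt _)).trans ?_
        unfold distPt
        split_ifs
        exacts [hr_self _ (cA.pt_mem _), rfl]
      · refine (hEsupp _).trans ?_
        refine Eq.trans ?_ (hJ'supp _).symm
        refine (distSupp_eq hr_self _ _ (hle f.2) (cW.isChainBetween _) ?_).trans (hJ'supp _)
        exact (Eq.subset (hJ'supp _)).trans (cA.supp_subset _)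

end ChainSupport

end TwoCat

/-! ### Induction on the cells of `C₂ X`, and nerves of posets up to dimension 3 -/

namespace SSet

open TwoPresentation TwoCat

section induction

variable {X : SSet.{u}}

/-- 1-cells are classes of paths of edges, which are built by adding one edge at the end. -/
lemma C₂.hom_induction {motive : ∀ {x y : C₂ X}, (x ⟶ y) → Prop}
    (id : ∀ x : C₂ X, motive (𝟙 x))
    (comp : ∀ {x : C₂ X} {y z : Vertex X} (f : x ⟶ ⟨ver y⟩) (e : Edge y.pt z.pt),
      motive f → motive (f ≫ edg e)) {x y : C₂ X} (f : x ⟶ y) : motive f := by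
  obtain ⟨⟨x⟩⟩ := x
  obtain ⟨⟨y⟩⟩ := y
  obtain ⟨p, rfl⟩ : ∃ p : Quiver.Path (V := Vertex X) x y,
      (Quotient.functor (DegenRel X)).map (X := x) (Y := y) p = f :=
    (Quotient.functor (DegenRel X)).map_surjective f
  induction p with
  | nil => exact id _
  | cons p e ih => exact comp _ e ih

/-- Induction on formal 2-cells, with formal equalities replaced by `eqToHom` so that the cases
speak only of the bicategory `C₂ X`. -/
lemma C₂.hom₂_induction {motive : ∀ {x y : C₂ X} {f g : x ⟶ y}, (f ⟶ g) → Prop}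
    (triangle : ∀ {x₀ x₁ x₂ : Vertex X} {e₀₁ : Edge x₀.pt x₁.pt} {e₁₂ : Edge x₁.pt x₂.pt}
      {e₀₂ : Edge x₀.pt x₂.pt} (h : Edge.CompStruct e₀₁ e₁₂ e₀₂), motive (tri h))
    (eqToHom : ∀ {x y : C₂ X} {f g : x ⟶ y} (h : f = g), motive (eqToHom h))
    (comp : ∀ {x y : C₂ X} {f g h : x ⟶ y} (η : f ⟶ g) (θ : g ⟶ h), motive η → motive θ →
      motive (η ≫ θ))
    (whiskerLeft : ∀ {x y z : C₂ X} (f : x ⟶ y) {g h : y ⟶ z} (η : g ⟶ h), motive η →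
      motive (f ◁ η))
    (whiskerRight : ∀ {x y z : C₂ X} {f g : x ⟶ y} (η : f ⟶ g) (h : y ⟶ z), motive η →
      motive (η ▷ h))
    {x y : C₂ X} {f g : x ⟶ y} (η : f ⟶ g) : motive η := by
  obtain ⟨a⟩ := η
  obtain ⟨x⟩ := x
  obtain ⟨y⟩ := y
  have key {x y : OneCells X} {f g : x ⟶ y} (a : PreCell (Triangle X) f g) :
      motive (x := ⟨x⟩) (y := ⟨y⟩) (f := f) (g := g) (Cell.mk (TetraRel X) a) := by
    induction a with
    | gen a => cases a with | tri h => exact triangle h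
    | eqTo h =>
      exact (congrArg (motive (x := ⟨_⟩) (y := ⟨_⟩))
        (mk_eqTo (r := TetraRel X) (x := ⟨_⟩) (y := ⟨_⟩) h)).mpr (eqToHom (x := ⟨_⟩) (y := ⟨_⟩) h)
    | vcomp a b ha hb => exact comp _ _ ha hb
    | whiskerL f a ha => exact whiskerLeft (x := ⟨_⟩) (y := ⟨_⟩) (z := ⟨_⟩) f _ ha
    | whiskerR a h ha => exact whiskerRight (x := ⟨_⟩) (y := ⟨_⟩) (z := ⟨_⟩) _ h ha
  exact key a

end induction

open Opposite in
/-- The simplicial set `X` is isomorphic in low dimensions to the nerve of the subset `S` of the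
partial order `P`. -/
structure NerveModel (X : SSet.{u}) {P : Type u'} [PartialOrder P] (S : Set P) where
  /-- The point corresponding to a vertex. -/
  pt : X.obj (op (.mk 0)) → P
  pt_injective : Function.Injective pt
  range_pt : Set.range pt = S
  le_of_edge {x y : X.obj (op (.mk 0))} (e : Edge x y) : pt x ≤ pt y
  subsingleton_edge (x y : X.obj (op (.mk 0))) : Subsingleton (Edge x y)
  nonempty_edge {x y : X.obj (op (.mk 0))} (h : pt x ≤ pt y) : Nonempty (Edge x y)
  subsingleton_compStruct {x y z : X.obj (op (.mk 0))}
    (e₀₁ : Edge x y) (e₁₂ : Edge y z) (e₀₂ : Edge x z) :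
    Subsingleton (Edge.CompStruct e₀₁ e₁₂ e₀₂)
  nonempty_compStruct {x y z : X.obj (op (.mk 0))}
    (e₀₁ : Edge x y) (e₁₂ : Edge y z) (e₀₂ : Edge x z) :
    Nonempty (Edge.CompStruct e₀₁ e₁₂ e₀₂)
  exists_tetra {x₀ x₁ x₂ x₃ : X.obj (op (.mk 0))}
    {e₀₁ : Edge x₀ x₁} {e₁₂ : Edge x₁ x₂}
    {e₂₃ : Edge x₂ x₃} {e₀₂ : Edge x₀ x₂} {e₁₃ : Edge x₁ x₃}
    {e₀₃ : Edge x₀ x₃} (h₀₁₂ : Edge.CompStruct e₀₁ e₁₂ e₀₂)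
    (h₀₂₃ : Edge.CompStruct e₀₂ e₂₃ e₀₃) (h₁₂₃ : Edge.CompStruct e₁₂ e₂₃ e₁₃)
    (h₀₁₃ : Edge.CompStruct e₀₁ e₁₃ e₀₃) :
    ∃ τ : X.obj (op (.mk 3)),
      X.δ 3 τ = h₀₁₂.simplex ∧ X.δ 1 τ = h₀₂₃.simplex ∧ X.δ 0 τ = h₁₂₃.simplex ∧
        X.δ 2 τ = h₀₁₃.simplex

end SSet

/-! ### The category of chains -/

namespace TwoCat

/-- The points of a partial order, as the objects of the category of finite chains. -/
structure ChainCat (P : Type u) where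
  /-- The underlying point. -/
  as : P

instance (P : Type u) [PartialOrder P] : Category (ChainCat P) where
  Hom a b := {c : Set P // IsChainBetween a.as b.as c}
  id a := ⟨{a.as}, .singleton _⟩
  comp c c' := ⟨c.1 ∪ c'.1, c.2.union c'.2⟩
  id_comp c := Subtype.ext (by simpa using c.2.left_mem)
  comp_id c := Subtype.ext (by simpa using c.2.right_mem)
  assoc c c' c'' := Subtype.ext (Set.union_assoc _ _ _)

/-- A concatenation at `b` determines its two parts, as the points below and above `b`; hence
factorizations of 1-cells through a given object are unique. -/
lemma IsChainBetween.left_eq_of_union {P : Type*} [PartialOrder P] {a b d : P} {c c' : Set P}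
    (h : IsChainBetween a b c) (h' : IsChainBetween b d c') : c = {z ∈ c ∪ c' | z ≤ b} := by
  ext z
  constructor
  · exact fun hz => ⟨.inl hz, h.le_right z hz⟩
  · rintro ⟨hz | hz, hzb⟩
    · exact hz
    · rw [le_antisymm hzb (h'.left_le z hz)]
      exact h.right_mem

lemma IsChainBetween.right_eq_of_union {P : Type*} [PartialOrder P] {a b d : P} {c c' : Set P}
    (h : IsChainBetween a b c) (h' : IsChainBetween b d c') : c' = {z ∈ c ∪ c' | b ≤ z} := by
  ext z
  constructor
  · exact fun hz => ⟨.inr hz, h'.left_le z hz⟩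
  · rintro ⟨hz | hz, hzb⟩
    · rw [le_antisymm (h.le_right z hz) hzb]
      exact h'.left_mem
    · exact hz

lemma IsChainBetween.split {P : Type*} [PartialOrder P] {a b d : P} {c : Set P}
    (h : IsChainBetween a d c) (hb : b ∈ c) :
    IsChainBetween a b {z ∈ c | z ≤ b} ∧ IsChainBetween b d {z ∈ c | b ≤ z} ∧
      {z ∈ c | z ≤ b} ∪ {z ∈ c | b ≤ z} = c := by
  refine ⟨⟨⟨h.left_mem, h.left_le _ hb⟩, ⟨hb, le_rfl⟩, fun z hz => h.left_le z hz.1,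
      fun z hz => hz.2, fun x hx y hy => h.total x hx.1 y hy.1, h.finite.subset fun z hz => hz.1⟩,
    ⟨⟨hb, le_rfl⟩, ⟨h.right_mem, h.le_right _ hb⟩, fun z hz => hz.2,
      fun z hz => h.le_right z hz.1, fun x hx y hy => h.total x hx.1 y hy.1,
      h.finite.subset fun z hz => hz.1⟩, ?_⟩
  ext z
  constructor
  · rintro (hz | hz) <;> exact hz.1
  · exact fun hz => (h.total z hz b hb).imp (⟨hz, ·⟩) (⟨hz, ·⟩)

end TwoCat

/-! ### 1-cells of `C₂` of the nerve of a poset are finite chains -/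

namespace SSet.NerveModel

open TwoPresentation TwoCat

variable {X : SSet.{u}} {P : Type u'} [PartialOrder P] {S : Set P} (M : NerveModel X S)

/-- The functor sending a 1-cell to its chain of vertices. -/
def suppFunctor : OneCells X ⥤ ChainCat P :=
  CategoryTheory.Quotient.lift _
    (Paths.lift
      { obj x := ⟨M.pt x.pt⟩
        map {x y} (e : Edge x.pt y.pt) := ⟨{M.pt x.pt, M.pt y.pt}, .pair (M.le_of_edge e)⟩ })
    (by
      rintro a b f g ⟨x⟩
      refine (Paths.lift_toPath _ _).trans ?_
      refine Eq.trans ?_ (CategoryTheory.Functor.map_id _ _).symm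
      exact Subtype.ext (Set.pair_eq_singleton _))

/-- The point corresponding to an object. -/
def ptObj (x : C₂ X) : P := M.pt (Vertex.pt x.as.as)

/-- The chain of vertices of a 1-cell. -/
def supp {x y : C₂ X} (f : x ⟶ y) : Set P :=
  (M.suppFunctor.map (X := x.as) (Y := y.as) f).1

lemma isChainBetween {x y : C₂ X} (f : x ⟶ y) :
    IsChainBetween (M.ptObj x) (M.ptObj y) (M.supp f) :=
  (M.suppFunctor.map (X := x.as) (Y := y.as) f).2

lemma supp_id (x : C₂ X) : M.supp (𝟙 x) = {M.ptObj x} :=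
  congrArg Subtype.val (M.suppFunctor.map_id x.as)

lemma supp_comp {x y z : C₂ X} (f : x ⟶ y) (g : y ⟶ z) :
    M.supp (f ≫ g) = M.supp f ∪ M.supp g :=
  congrArg Subtype.val (M.suppFunctor.map_comp (X := x.as) (Y := y.as) (Z := z.as) f g)

lemma supp_edg {x y : Vertex X} (e : Edge x.pt y.pt) :
    M.supp (edg e) = {M.pt x.pt, M.pt y.pt} := by
  have : M.suppFunctor.map (arr e) = ⟨{M.pt x.pt, M.pt y.pt}, .pair (M.le_of_edge e)⟩ :=
    Paths.lift_toPath _ _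
  exact congrArg Subtype.val this

lemma ptObj_injective : Function.Injective M.ptObj := by
  rintro ⟨⟨x⟩⟩ ⟨⟨y⟩⟩ h
  have : Vertex.pt x = Vertex.pt y := M.pt_injective h
  obtain ⟨x⟩ := x
  obtain ⟨y⟩ := y
  obtain rfl : x = y := this
  rfl

lemma range_ptObj : Set.range M.ptObj = S := by
  refine Eq.trans ?_ M.range_pt
  ext p
  constructor
  · rintro ⟨x, rfl⟩
    exact ⟨_, rfl⟩
  · rintro ⟨x, rfl⟩
    exact ⟨⟨ver ⟨x⟩⟩, rfl⟩

lemma ptObj_mem (x : C₂ X) : M.ptObj x ∈ S := by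
  simpa only [M.range_ptObj] using Set.mem_range_self (f := M.ptObj) x

lemma supp_subset {x y : C₂ X} (f : x ⟶ y) : M.supp f ⊆ S := by
  induction f using C₂.hom_induction with
  | id x => rw [supp_id, Set.singleton_subset_iff]; exact M.ptObj_mem x
  | @comp x y z f e ih =>
    rw [supp_comp, supp_edg, Set.union_subset_iff, Set.insert_subset_iff,
      Set.singleton_subset_iff]
    exact ⟨ih, M.ptObj_mem ⟨ver y⟩, M.ptObj_mem ⟨ver z⟩⟩

/-- A path can be cut at any vertex it visits: either the vertex occurs before the last edge, or it
is an end of that edge. -/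
lemma exists_factor {x z : C₂ X} (f : x ⟶ z) {y : C₂ X} (hy : M.ptObj y ∈ M.supp f) :
    ∃ (f₁ : x ⟶ y) (f₂ : y ⟶ z), f = f₁ ≫ f₂ := by
  induction f using C₂.hom_induction with
  | id x =>
    rw [supp_id] at hy
    obtain rfl := M.ptObj_injective hy
    exact ⟨𝟙 _, 𝟙 _, (Strict.id_comp _).symm⟩
  | @comp x w z f e ih =>
    rw [supp_comp] at hy
    by_cases h : M.ptObj y ∈ M.supp f
    · obtain ⟨f₁, f₂, rfl⟩ := ih h
      exact ⟨f₁, f₂ ≫ edg e, Strict.assoc _ _ _⟩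
    · have hy' := hy.resolve_left h
      rw [supp_edg] at hy'
      obtain hy' | hy' := hy'
      · obtain rfl : y = ⟨ver w⟩ := M.ptObj_injective hy'
        exact ⟨f, edg e, rfl⟩
      · obtain rfl : y = ⟨ver z⟩ := M.ptObj_injective hy'
        exact ⟨f ≫ edg e, 𝟙 _, (Strict.comp_id _).symm⟩

/-- On a path meeting no point besides its ends, at most one edge joins distinct points. The others
join a point to itself, so by uniqueness of edges they are degenerate, hence identities. -/
lemma eq_edg {x y : C₂ X} (f : x ⟶ y) (h : M.supp f ⊆ {M.ptObj x, M.ptObj y})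
    (e : Edge (Vertex.pt x.as.as) (Vertex.pt y.as.as)) :
    f = edg (x := x.as.as) (y := y.as.as) e := by
  have := M.subsingleton_edge
  induction f using C₂.hom_induction with
  | id x =>
    obtain rfl : e = Edge.id _ := Subsingleton.elim _ _
    exact (edg_id _).symm
  | @comp x y z f e' ih =>
    have hy : M.ptObj ⟨ver y⟩ ∈ M.supp (f ≫ edg e') := by
      rw [supp_comp]
      exact .inl (M.isChainBetween f).right_mem
    obtain hy | hy := h hy
    · obtain rfl := M.ptObj_injective hy
      obtain rfl : e' = e := Subsingleton.elim _ _
      rw [ih (by rw [(M.isChainBetween f).eq_singleton]; simp) (Edge.id _)]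
      exact (congrArg (· ≫ edg e') (edg_id y)).trans (Strict.id_comp _)
    · obtain rfl : y = z := congrArg (fun x : C₂ X => x.as.as) (M.ptObj_injective hy)
      obtain rfl : e' = Edge.id _ := Subsingleton.elim _ _
      refine Eq.trans ?_ (ih ?_ e)
      · rw [edg_id]
        exact Strict.comp_id _
      · refine Set.Subset.trans ?_ h
        rw [supp_comp]
        exact Set.subset_union_left

lemma eq_id (M : NerveModel X S) {x : C₂ X} (f : x ⟶ x) : f = 𝟙 x :=
  (M.eq_edg f (by rw [(M.isChainBetween f).eq_singleton]; simp) (Edge.id _)).trans (edg_id _)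

/-- The start of the last edge of `f` also lies on `g`. Cutting `g` there gives parts with the same
chains as those of `f`; the first is handled by induction, the second by `eq_edg`. -/
lemma supp_injective {x y : C₂ X} {f g : x ⟶ y} (h : M.supp f = M.supp g) : f = g := by
  induction f using C₂.hom_induction with
  | id x => exact (M.eq_id g).symm
  | @comp x y z f e ih =>
    have hy : M.ptObj ⟨ver y⟩ ∈ M.supp g := by
      rw [← h, supp_comp]
      exact .inl (M.isChainBetween f).right_mem
    obtain ⟨g₁, g₂, rfl⟩ := M.exists_factor g hy
    have h₁ := (M.isChainBetween f).left_eq_of_union (M.isChainBetween (edg e))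
    have h₂ := (M.isChainBetween f).right_eq_of_union (M.isChainBetween (edg e))
    rw [← supp_comp, h, supp_comp] at h₁ h₂
    rw [← (M.isChainBetween g₁).left_eq_of_union (M.isChainBetween g₂)] at h₁
    rw [← (M.isChainBetween g₁).right_eq_of_union (M.isChainBetween g₂)] at h₂
    rw [ih h₁, M.eq_edg g₂ (by rw [← h₂, supp_edg]; rfl) e]
    rfl

lemma factor_unique (M : NerveModel X S) {x y z : C₂ X} {f f' : x ⟶ y} {g g' : y ⟶ z}
    (h : f ≫ g = f' ≫ g') :
    f = f' ∧ g = g' := by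
  have h' : M.supp f ∪ M.supp g = M.supp f' ∪ M.supp g' := by rw [← supp_comp, h, supp_comp]
  constructor <;> apply M.supp_injective
  · rw [(M.isChainBetween f).left_eq_of_union (M.isChainBetween g), h',
      ← (M.isChainBetween f').left_eq_of_union (M.isChainBetween g')]
  · rw [(M.isChainBetween f).right_eq_of_union (M.isChainBetween g), h',
      ← (M.isChainBetween f').right_eq_of_union (M.isChainBetween g')]

/-- Induction on the size of `c`: two ends are joined by an edge, and any other point splits `c`
into two smaller chains. -/
lemma exists_supp {x y : C₂ X} {c : Set P} (hc : IsChainBetween (M.ptObj x) (M.ptObj y) c)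
    (hS : c ⊆ S) : ∃ f : x ⟶ y, M.supp f = c := by
  induction hn : c.ncard using Nat.strong_induction_on generalizing x y c with
  | _ n ih =>
    by_cases h : c ⊆ {M.ptObj x, M.ptObj y}
    · obtain ⟨e⟩ := M.nonempty_edge hc.le
      refine ⟨edg (x := x.as.as) (y := y.as.as) e, (M.supp_edg e).trans (h.antisymm' ?_)⟩
      rintro z (rfl | rfl)
      exacts [hc.left_mem, hc.right_mem]
    · obtain ⟨b, hb, hb'⟩ := Set.not_subset.1 h
      simp only [Set.mem_insert_iff, Set.mem_singleton_iff, not_or] at hb'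
      obtain ⟨w, rfl⟩ : ∃ w, M.ptObj w = b := by
        have := hS hb
        rwa [← M.range_ptObj] at this
      obtain ⟨h₁, h₂, h₃⟩ := hc.split hb
      obtain ⟨f, hf⟩ := ih _ (by
        rw [← hn]
        refine Set.ncard_lt_ncard ⟨fun z hz => hz.1, fun h => ?_⟩ hc.finite
        exact hb'.2 (le_antisymm (hc.le_right _ hb) (h hc.right_mem).2)) h₁
        (fun z hz => hS hz.1) rfl
      obtain ⟨g, hg⟩ := ih _ (by
        rw [← hn]
        refine Set.ncard_lt_ncard ⟨fun z hz => hz.1, fun h => ?_⟩ hc.finite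
        exact hb'.1 (le_antisymm (h hc.left_mem).2 (hc.left_le _ hb))) h₂
        (fun z hz => hS hz.1) rfl
      exact ⟨f ≫ g, by rw [supp_comp, hf, hg, h₃]⟩

end SSet.NerveModel

/-! ### 2-cells of `C₂` of the nerve of a poset: existence and uniqueness -/

namespace SSet.NerveModel

open TwoPresentation TwoCat

variable {X : SSet.{u}} {P : Type u'} [PartialOrder P] {S : Set P} (M : NerveModel X S)

lemma le {x y : C₂ X} (f : x ⟶ y) : M.ptObj x ≤ M.ptObj y := (M.isChainBetween f).le

/-- The 1-cell given by the edge between two comparable points. -/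
noncomputable def top {x y : C₂ X} (h : M.ptObj x ≤ M.ptObj y) : x ⟶ y :=
  edg (x := x.as.as) (y := y.as.as) (M.nonempty_edge h).some

lemma edg_eq_top {x y : Vertex X} (e : Edge x.pt y.pt) : edg e = M.top (M.le (edg e)) := by
  have := M.subsingleton_edge
  exact congrArg _ (Subsingleton.elim _ _)

lemma id_eq_top (x : C₂ X) : 𝟙 x = M.top (M.le (𝟙 x)) := (M.eq_id _).symm

/-- The 2-cell given by the triangle on three comparable points. -/
noncomputable def comparison {x y z : C₂ X} (h : M.ptObj x ≤ M.ptObj y)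
    (h' : M.ptObj y ≤ M.ptObj z) : M.top h ≫ M.top h' ⟶ M.top (h.trans h') :=
  tri (x₀ := x.as.as) (x₁ := y.as.as) (x₂ := z.as.as) (M.nonempty_compStruct _ _ _).some

lemma tri_eq_comparison {x₀ x₁ x₂ : Vertex X} {e₀₁ : Edge x₀.pt x₁.pt} {e₁₂ : Edge x₁.pt x₂.pt}
    {e₀₂ : Edge x₀.pt x₂.pt} (h : Edge.CompStruct e₀₁ e₁₂ e₀₂) :
    tri h = eqToHom (by rw [← M.edg_eq_top, ← M.edg_eq_top]) ≫
      M.comparison (M.le (edg e₀₁)) (M.le (edg e₁₂)) ≫ eqToHom (M.edg_eq_top e₀₂).symm := by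
  have := M.subsingleton_edge
  -- The inequalities and equalities are generalized so that each edge can be replaced by the chosen
  -- one.
  have key (h₁ : M.ptObj ⟨ver x₀⟩ ≤ M.ptObj ⟨ver x₁⟩) (h₂ : M.ptObj ⟨ver x₁⟩ ≤ M.ptObj ⟨ver x₂⟩)
      (p : edg e₀₁ ≫ edg e₁₂ = M.top h₁ ≫ M.top h₂) (q : M.top (h₁.trans h₂) = edg e₀₂) :
      tri h = eqToHom p ≫ M.comparison h₁ h₂ ≫ eqToHom q := by
    obtain rfl : e₀₁ = (M.nonempty_edge h₁).some := Subsingleton.elim _ _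
    obtain rfl : e₁₂ = (M.nonempty_edge h₂).some := Subsingleton.elim _ _
    obtain rfl : e₀₂ = (M.nonempty_edge (h₁.trans h₂)).some := Subsingleton.elim _ _
    obtain rfl : h = (M.nonempty_compStruct _ _ _).some :=
      (M.subsingleton_compStruct _ _ _).elim _ _
    exact ((Category.id_comp _).trans (Category.comp_id _)).symm
  exact key _ _ _ _

/-- A triangle is determined by its edges, so one on `x, x, y` is degenerate. -/
lemma comparison_left {x y : C₂ X} (h : M.ptObj x ≤ M.ptObj y) (h' : M.ptObj x ≤ M.ptObj x) :
    M.comparison h' h = eqToHom (by rw [M.eq_id (M.top h'), Strict.id_comp]) := by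
  have := M.subsingleton_edge
  have := @M.subsingleton_compStruct
  have key {e₀₁ : Edge (Vertex.pt x.as.as) (Vertex.pt x.as.as)}
    {e e' : Edge (Vertex.pt x.as.as) (Vertex.pt y.as.as)} (t : Edge.CompStruct e₀₁ e e') :
      t.simplex = X.σ 0 e.edge := by
    obtain rfl : e₀₁ = Edge.id _ := Subsingleton.elim _ _
    obtain rfl : e = e' := Subsingleton.elim _ _
    obtain rfl : t = Edge.CompStruct.idComp e := Subsingleton.elim _ _
    rfl
  exact tri_degen₀ (x := x.as.as) (y := y.as.as) _ (Subsingleton.elim _ _) rfl (key _)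

lemma comparison_right {x y : C₂ X} (h : M.ptObj x ≤ M.ptObj y) (h' : M.ptObj y ≤ M.ptObj y) :
    M.comparison h h' = eqToHom (by rw [M.eq_id (M.top h'), Strict.comp_id]) := by
  have := M.subsingleton_edge
  have := @M.subsingleton_compStruct
  have key {e₁₂ : Edge (Vertex.pt y.as.as) (Vertex.pt y.as.as)}
    {e e' : Edge (Vertex.pt x.as.as) (Vertex.pt y.as.as)} (t : Edge.CompStruct e e₁₂ e') :
      t.simplex = X.σ 1 e.edge := by
    obtain rfl : e₁₂ = Edge.id _ := Subsingleton.elim _ _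
    obtain rfl : e = e' := Subsingleton.elim _ _
    obtain rfl : t = Edge.CompStruct.compId e := Subsingleton.elim _ _
    rfl
  exact tri_degen₁ (x := x.as.as) (y := y.as.as) _ (Subsingleton.elim _ _) rfl (key _)

/-- This is the relation imposed by the 3-simplex on the four points. -/
lemma comparison_assoc {x y z t : C₂ X} (h : M.ptObj x ≤ M.ptObj y)
    (h' : M.ptObj y ≤ M.ptObj z) (h'' : M.ptObj z ≤ M.ptObj t) :
    M.comparison h h' ▷ M.top h'' ≫ M.comparison (h.trans h') h'' =
      (α_ _ _ _).hom ≫ M.top h ◁ M.comparison h' h'' ≫ M.comparison h (h'.trans h'') := by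
  obtain ⟨τ, d₃, d₁, d₀, d₂⟩ := M.exists_tetra
    (M.nonempty_compStruct (M.nonempty_edge h).some (M.nonempty_edge h').some
      (M.nonempty_edge (h.trans h')).some).some
    (M.nonempty_compStruct (M.nonempty_edge (h.trans h')).some (M.nonempty_edge h'').some
      (M.nonempty_edge (h.trans (h'.trans h''))).some).some
    (M.nonempty_compStruct (M.nonempty_edge h').some (M.nonempty_edge h'').some
      (M.nonempty_edge (h'.trans h'')).some).some
    (M.nonempty_compStruct (M.nonempty_edge h).some (M.nonempty_edge (h'.trans h'')).some
      (M.nonempty_edge (h.trans (h'.trans h''))).some).some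
  rw [Strict.associator_eqToIso, eqToIso.hom]
  exact tri_tetra (x₀ := x.as.as) (x₁ := y.as.as) (x₂ := z.as.as) (x₃ := t.as.as)
    _ _ _ _ τ d₃ d₁ d₀ d₂

/-- Composition of 2-cells towards the 1-cells given by edges. -/
noncomputable def coneComp {x y z : C₂ X} {f : x ⟶ y} {g : y ⟶ z} (κ : f ⟶ M.top (M.le f))
    (κ' : g ⟶ M.top (M.le g)) : f ≫ g ⟶ M.top (M.le (f ≫ g)) :=
  κ ▷ g ≫ M.top (M.le f) ◁ κ' ≫ M.comparison (M.le f) (M.le g)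

/-- The objects of the category whose morphisms are 1-cells equipped with a 2-cell to an edge. -/
structure ConeCat (M : NerveModel X S) where
  /-- The underlying object. -/
  as : C₂ X

lemma cone_ext {x y : C₂ X} {f f' : x ⟶ y} (h : f = f') {κ : f ⟶ M.top (M.le f)}
    {κ' : f' ⟶ M.top (M.le f')} (hκ : κ = eqToHom h ≫ κ') :
    (⟨f, κ⟩ : Σ f : x ⟶ y, f ⟶ M.top (M.le f)) = ⟨f', κ'⟩ := by
  subst h hκ
  simp

lemma coneComp_assoc {x y z t : C₂ X} {f : x ⟶ y} {g : y ⟶ z} {k : z ⟶ t}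
    (κf : f ⟶ M.top (M.le f)) (κg : g ⟶ M.top (M.le g)) (κk : k ⟶ M.top (M.le k)) :
    M.coneComp (M.coneComp κf κg) κk =
      eqToHom (Strict.assoc f g k) ≫ M.coneComp κf (M.coneComp κg κk) := by
  have key := M.comparison_assoc (M.le f) (M.le g) (M.le k)
  have := Strict.associator_eqToIso f g k
  rw [show eqToHom (Strict.assoc f g k) = (α_ f g k).hom by rw [this]; rfl]
  simp only [coneComp, comp_whiskerRight, Category.assoc]
  rw [← whisker_exchange_assoc, key]
  simp

/-- The canonical 2-cell from a 1-cell to the edge must not depend on the path chosen. Making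
1-cells with such a 2-cell into a category turns its construction into a functor on `OneCells X`,
for which only degenerate edges have to be checked. -/
noncomputable instance : Category (ConeCat M) where
  Hom x y := Σ f : x.as ⟶ y.as, f ⟶ M.top (M.le f)
  id x := ⟨𝟙 x.as, eqToHom (M.id_eq_top x.as)⟩
  comp f g := ⟨f.1 ≫ g.1, M.coneComp f.2 g.2⟩
  id_comp f := M.cone_ext (Strict.id_comp _) (by
    rw [coneComp, comparison_left, whiskerLeft_of_eq_id (M.eq_id _)]
    simp)
  comp_id f := M.cone_ext (Strict.comp_id _) (by
    rw [coneComp, comparison_right, whiskerRight_of_eq_id rfl]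
    simp)
  assoc f g h := M.cone_ext (Strict.assoc _ _ _) (M.coneComp_assoc _ _ _)

/-- The section of the projection from 1-cells equipped with a 2-cell to an edge. -/
noncomputable def coneFunctor : OneCells X ⥤ ConeCat M :=
  CategoryTheory.Quotient.lift _
    (Paths.lift
      { obj x := ⟨⟨ver x⟩⟩
        map {x y} (e : Edge x.pt y.pt) := ⟨edg e, eqToHom (M.edg_eq_top e)⟩ })
    (by
      rintro a b f g ⟨x⟩
      refine (Paths.lift_toPath _ _).trans ?_
      refine Eq.trans ?_ (CategoryTheory.Functor.map_id _ _).symm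
      exact M.cone_ext (edg_id x) (eqToHom_trans _ _).symm)

lemma coneFunctor_map_arr {x y : Vertex X} (e : Edge x.pt y.pt) :
    M.coneFunctor.map (arr e) = ⟨edg e, eqToHom (M.edg_eq_top e)⟩ :=
  Paths.lift_toPath _ _

lemma coneFunctor_map_fst {x y : C₂ X} (f : x ⟶ y) :
    (M.coneFunctor.map (X := x.as) (Y := y.as) f).1 = f := by
  induction f using C₂.hom_induction with
  | id x => exact congrArg Sigma.fst (M.coneFunctor.map_id x.as)
  | @comp x y z f e ih =>
    refine (congrArg Sigma.fst (M.coneFunctor.map_comp (X := x.as) (Y := ver y) (Z := ver z)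
      f (arr e))).trans ?_
    rw [coneFunctor_map_arr]
    exact congrArg (· ≫ edg e) ih

/-- The canonical 2-cell from a 1-cell to an edge. -/
noncomputable def cone {x y : C₂ X} (f : x ⟶ y) : f ⟶ M.top (M.le f) :=
  eqToHom (M.coneFunctor_map_fst f).symm ≫ (M.coneFunctor.map (X := x.as) (Y := y.as) f).2

lemma coneFunctor_map {x y : C₂ X} (f : x ⟶ y) :
    M.coneFunctor.map (X := x.as) (Y := y.as) f = ⟨f, M.cone f⟩ := by
  have key (s : Σ f : x ⟶ y, f ⟶ M.top (M.le f)) (h : s.1 = f) :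
      s = ⟨f, eqToHom h.symm ≫ s.2⟩ := by
    subst h
    simp
  exact key _ (M.coneFunctor_map_fst f)

lemma cone_id (x : C₂ X) : M.cone (𝟙 x) = eqToHom (M.id_eq_top x) :=
  eq_of_heq (Sigma.mk.inj ((M.coneFunctor_map (𝟙 x)).symm.trans
    (M.coneFunctor.map_id x.as))).2

lemma cone_edg {x y : Vertex X} (e : Edge x.pt y.pt) :
    M.cone (edg e) = eqToHom (M.edg_eq_top e) :=
  eq_of_heq (Sigma.mk.inj ((M.coneFunctor_map (edg e)).symm.trans
    (M.coneFunctor_map_arr e))).2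

lemma cone_comp {x y z : C₂ X} (f : x ⟶ y) (g : y ⟶ z) :
    M.cone (f ≫ g) = M.coneComp (M.cone f) (M.cone g) := by
  have h := M.coneFunctor.map_comp (X := x.as) (Y := y.as) (Z := z.as) f g
  rw [M.coneFunctor_map f, M.coneFunctor_map g] at h
  exact eq_of_heq (Sigma.mk.inj ((M.coneFunctor_map (f ≫ g)).symm.trans h)).2

/-- It suffices to check generators: triangles are absorbed into `comparison`, and left whiskering
uses the interchange law. Since the cone of an edge is invertible, an edge is therefore terminal in
its hom-category. -/
lemma comp_cone {x y : C₂ X} {f g : x ⟶ y} (η : f ⟶ g) : η ≫ M.cone g = M.cone f := by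
  induction η using C₂.hom₂_induction with
  | @triangle x₀ x₁ x₂ e₀₁ e₁₂ e₀₂ h =>
    rw [cone_edg, cone_comp, coneComp, cone_edg, cone_edg, M.tri_eq_comparison]
    simp
  | eqToHom h =>
    subst h
    simp
  | comp η θ hη hθ => rw [Category.assoc, hθ, hη]
  | whiskerLeft f η hη =>
    rw [cone_comp, cone_comp, coneComp, coneComp, whisker_exchange_assoc, ← hη]
    simp
  | whiskerRight η h hη =>
    rw [cone_comp, cone_comp, coneComp, coneComp, ← hη]
    simp

lemma hom_edg_unique (M : NerveModel X S) {x y : Vertex X}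
    {f : (⟨ver x⟩ : C₂ X) ⟶ ⟨ver y⟩} {e : Edge x.pt y.pt}
    (η θ : f ⟶ edg e) : η = θ := by
  rw [← cancel_mono (eqToHom (M.edg_eq_top e)), ← M.cone_edg, comp_cone, comp_cone]

lemma hom_id_unique (M : NerveModel X S) {x : C₂ X} {f : x ⟶ x} (η θ : f ⟶ 𝟙 x) : η = θ := by
  rw [← cancel_mono (eqToHom (M.id_eq_top x)), ← M.cone_id, comp_cone, comp_cone]

/-- Induction on `η`. A triangle has only its two ends in its codomain, so the cut there is trivial.
For a whiskering, the cut point lies on one of the two factors, and `factor_unique` identifies the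
resulting parts with `g₁` and `g₂`. Vertical composites are reassembled by the interchange law. -/
lemma hom_split (M : NerveModel X S) {x z : C₂ X} {f g : x ⟶ z} (η : f ⟶ g) {y : C₂ X}
    (g₁ : x ⟶ y) (g₂ : y ⟶ z)
    (hg : g = g₁ ≫ g₂) : ∃ (f₁ : x ⟶ y) (f₂ : y ⟶ z) (hf : f = f₁ ≫ f₂) (η₁ : f₁ ⟶ g₁)
      (η₂ : f₂ ⟶ g₂), η = eqToHom hf ≫ η₁ ▷ f₂ ≫ g₁ ◁ η₂ ≫ eqToHom hg.symm := by
  induction η using C₂.hom₂_induction generalizing y with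
  | @triangle x₀ x₁ x₂ e₀₁ e₁₂ e₀₂ h =>
    have hy : M.ptObj y ∈ M.supp (edg e₀₂) := by
      rw [hg, supp_comp]
      exact .inl (M.isChainBetween g₁).right_mem
    rw [supp_edg] at hy
    obtain hy | hy := hy
    · obtain rfl : y = ⟨ver x₀⟩ := M.ptObj_injective hy
      obtain rfl := M.eq_id g₁
      obtain rfl : edg e₀₂ = g₂ := hg.trans (Strict.id_comp _)
      refine ⟨𝟙 _, _, (Strict.id_comp _).symm, 𝟙 _, tri h, ?_⟩
      rw [whiskerLeft_of_eq_id rfl]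
      simp
    · obtain rfl : y = ⟨ver x₂⟩ := M.ptObj_injective hy
      obtain rfl := M.eq_id g₂
      obtain rfl : edg e₀₂ = g₁ := hg.trans (Strict.comp_id _)
      refine ⟨_, 𝟙 _, (Strict.comp_id _).symm, tri h, 𝟙 _, ?_⟩
      rw [whiskerRight_of_eq_id rfl]
      simp
  | eqToHom h =>
    subst h hg
    exact ⟨g₁, g₂, rfl, 𝟙 _, 𝟙 _, by simp⟩
  | comp η θ hη hθ =>
    obtain ⟨f₁, f₂, hf, θ₁, θ₂, rfl⟩ := hθ g₁ g₂ hg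
    obtain ⟨k₁, k₂, hk, η₁, η₂, rfl⟩ := hη f₁ f₂ hf
    subst hg hf hk
    refine ⟨k₁, k₂, rfl, η₁ ≫ θ₁, η₂ ≫ θ₂, ?_⟩
    simp [whisker_exchange_assoc]
  | @whiskerLeft x w z f g h η ih =>
    have hy : M.ptObj y ∈ M.supp (f ≫ h) := by
      rw [hg, supp_comp]
      exact .inl (M.isChainBetween g₁).right_mem
    rw [supp_comp] at hy
    obtain hy | hy := hy
    · obtain ⟨f₁, f₂, rfl⟩ := M.exists_factor f hy
      obtain ⟨rfl, rfl⟩ := M.factor_unique ((Strict.assoc _ _ _).symm.trans hg)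
      refine ⟨f₁, f₂ ≫ g, Strict.assoc _ _ _, 𝟙 _, f₂ ◁ η, ?_⟩
      simp [Strict.associator_eqToIso]
    · obtain ⟨h₁, h₂, rfl⟩ := M.exists_factor h hy
      obtain ⟨rfl, rfl⟩ := M.factor_unique ((Strict.assoc _ _ _).trans hg)
      obtain ⟨k₁, k₂, rfl, η₁, η₂, rfl⟩ := ih h₁ h₂ rfl
      refine ⟨f ≫ k₁, k₂, (Strict.assoc _ _ _).symm, f ◁ η₁, η₂, ?_⟩
      simp [Strict.associator_eqToIso]
  | @whiskerRight x w z f g η h ih =>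
    have hy : M.ptObj y ∈ M.supp (g ≫ h) := by
      rw [hg, supp_comp]
      exact .inl (M.isChainBetween g₁).right_mem
    rw [supp_comp] at hy
    obtain hy | hy := hy
    · obtain ⟨h₁, h₂, rfl⟩ := M.exists_factor g hy
      obtain ⟨rfl, rfl⟩ := M.factor_unique ((Strict.assoc _ _ _).symm.trans hg)
      obtain ⟨k₁, k₂, rfl, η₁, η₂, rfl⟩ := ih h₁ h₂ rfl
      refine ⟨k₁, k₂ ≫ h, Strict.assoc _ _ _, η₁, η₂ ▷ h, ?_⟩
      simp [Strict.associator_eqToIso]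
    · obtain ⟨f₁, f₂, rfl⟩ := M.exists_factor h hy
      obtain ⟨rfl, rfl⟩ := M.factor_unique ((Strict.assoc _ _ _).trans hg)
      refine ⟨f ≫ f₁, f₂, (Strict.assoc _ _ _).symm, η ▷ f₁, 𝟙 _, ?_⟩
      simp [Strict.associator_eqToIso]

/-- Both 2-cells split along the last edge of the target, with the same pieces by `factor_unique`;
the pieces agree by induction and by terminality of the edge. -/
lemma hom_unique (M : NerveModel X S) {x y : C₂ X} {f g : x ⟶ y} (η θ : f ⟶ g) : η = θ := by
  induction g using C₂.hom_induction with
  | id x => exact M.hom_id_unique η θ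
  | @comp x y z g e ih =>
    obtain ⟨f₁, f₂, rfl, η₁, η₂, rfl⟩ := M.hom_split η g (edg e) rfl
    obtain ⟨f₁', f₂', hf, θ₁, θ₂, rfl⟩ := M.hom_split θ g (edg e) rfl
    obtain ⟨rfl, rfl⟩ := M.factor_unique hf
    rw [ih η₁ θ₁, M.hom_edg_unique η₂ θ₂]

lemma supp_subset_of_hom {x y : C₂ X} {f g : x ⟶ y} (η : f ⟶ g) : M.supp g ⊆ M.supp f := by
  induction η using C₂.hom₂_induction with
  | triangle h =>
    rw [supp_comp, supp_edg, supp_edg, supp_edg]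
    rintro z (rfl | rfl) <;> simp
  | eqToHom h => rw [h]
  | comp η θ hη hθ => exact hθ.trans hη
  | whiskerLeft f η hη =>
    rw [supp_comp, supp_comp]
    exact Set.union_subset_union_right _ hη
  | whiskerRight η h hη =>
    rw [supp_comp, supp_comp]
    exact Set.union_subset_union_left _ hη

/-- Cut `f` at the start of the last edge of the target, contract the second part to that edge by
`cone`, and treat the first part by induction. -/
lemma nonempty_hom {x y : C₂ X} {f g : x ⟶ y} (h : M.supp g ⊆ M.supp f) : Nonempty (f ⟶ g) := by
  induction g using C₂.hom_induction with
  | id x => exact ⟨eqToHom (M.eq_id f)⟩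
  | @comp x y z g e ih =>
    have hg := M.isChainBetween g
    have he := M.isChainBetween (edg e)
    obtain ⟨f₁, f₂, rfl⟩ := M.exists_factor f (y := ⟨ver y⟩) (h (by
      rw [supp_comp]; exact .inl hg.right_mem))
    rw [supp_comp, supp_comp] at h
    obtain ⟨η₁⟩ := ih (f := f₁) (by
      rw [hg.left_eq_of_union he,
        (M.isChainBetween f₁).left_eq_of_union (M.isChainBetween f₂)]
      exact fun z hz => ⟨h hz.1, hz.2⟩)
    exact ⟨η₁ ▷ f₂ ≫ g ◁ (M.cone f₂ ≫ eqToHom (M.edg_eq_top e).symm)⟩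

/-- The 2-category presented by the nerve of a partial order is the 2-category of chains. -/
def chainSupport : ChainSupport (C₂ X) S where
  pt := M.ptObj
  pt_injective := M.ptObj_injective
  range_pt := M.range_ptObj
  supp := M.supp
  isChainBetween := M.isChainBetween
  supp_subset := M.supp_subset
  supp_id := M.supp_id
  supp_comp := M.supp_comp
  supp_injective := M.supp_injective
  exists_supp := M.exists_supp
  subsingleton_hom _ _ := ⟨M.hom_unique⟩
  nonempty_hom_iff _ _ := ⟨fun ⟨η⟩ => M.supp_subset_of_hom η, M.nonempty_hom⟩

end SSet.NerveModel

/-! ### Maps out of a subdivision, and the comparison with a nerve of chains -/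

namespace SSet

open PartialOrder Opposite

section

variable {Q : Type u} [PartialOrder Q]

lemma _root_.PartialOrder.NonemptyFiniteChains.map_map {P Q R : Type*} [PartialOrder P]
    [PartialOrder Q] [PartialOrder R] (s : NonemptyFiniteChains P) (f : P →o Q) (g : Q →o R) :
    (s.map f).map g = s.map (g.comp f) := by
  ext q
  simp

/-- The monotone map given by the vertices of a simplex of a nerve. -/
def vertexMap {n : SimplexCategory} (s : (nerve Q).obj (op n)) :
    ULift.{u} (Fin (n.len + 1)) →o Q where
  toFun i := s.obj i.down
  monotone' _ _ h := s.monotone h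

lemma nerve_ext {n : SimplexCategory} {s t : (nerve Q).obj (op n)}
    (h : ∀ i, vertexMap s i = vertexMap t i) : s = t :=
  nerve.ext_of_isThin (funext fun i => h ⟨i⟩)

/-- The map from the subdivision of a simplex to the nerve of the chains of `Q` induced by a
simplex of the nerve of `Q`. -/
noncomputable def sdVertexMap {n : SimplexCategory} (s : (nerve Q).obj (op n)) :
    SimplexCategory.sd.{u}.obj n ⟶ nerve (NonemptyFiniteChains Q) :=
  nerveMap (NonemptyFiniteChains.orderHomMap (vertexMap s)).monotone.functor

/-- The vertices of a simplex of the subdivision of a simplex, as chains. -/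
noncomputable def sdChain {n m : SimplexCategory} (c : (SimplexCategory.sd.{u}.obj n).obj (op m)) :
    ULift.{u} (Fin (m.len + 1)) →o NonemptyFiniteChains (ULift.{u} (Fin (n.len + 1))) :=
  vertexMap (Q := NonemptyFiniteChains (ULift.{u} (Fin (n.len + 1)))) c

lemma vertexMap_sdVertexMap {n m : SimplexCategory} (s : (nerve Q).obj (op n))
    (c : (SimplexCategory.sd.{u}.obj n).obj (op m)) (i : ULift (Fin (m.len + 1))) :
    vertexMap ((sdVertexMap s).app _ c) i = (sdChain c i).map (vertexMap s) :=
  rfl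

/-- The monotone map between ulifted ordinals given by a morphism in the simplex category. -/
def ordinalMap {n m : SimplexCategory} (f : m ⟶ n) :
    ULift.{u} (Fin (m.len + 1)) →o ULift.{u} (Fin (n.len + 1)) where
  toFun i := ⟨f.toOrderHom i.down⟩
  monotone' _ _ h := f.toOrderHom.monotone h

lemma sd_map_sdVertexMap {n m : SimplexCategory} (f : m ⟶ n) (s : (nerve Q).obj (op n)) :
    SimplexCategory.sd.map f ≫ sdVertexMap s = sdVertexMap ((nerve Q).map f.op s) := by
  refine NatTrans.ext (funext fun k => ConcreteCategory.hom_ext _ _ fun c => ?_)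
  exact nerve_ext (s := (sdVertexMap s).app k ((SimplexCategory.sd.map f).app k c))
    (t := (sdVertexMap ((nerve Q).map f.op s)).app k c) (n := k.unop) fun i =>
    NonemptyFiniteChains.map_map (sdChain (m := k.unop) c i) (ordinalMap f) (vertexMap s)

variable {X Y : SSet.{u}}

/-- The map between subdivisions induced by a simplex. -/
noncomputable def sdι {n : SimplexCategory} (x : X.obj (op n)) :
    SimplexCategory.sd.obj n ⟶ sd.obj X :=
  stdSimplex.sdIso.inv.app n ≫ sd.map (yonedaEquiv.symm x)

lemma sd_map_sdι {n m : SimplexCategory} (f : m ⟶ n) (x : X.obj (op n)) :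
    SimplexCategory.sd.map f ≫ sdι x = sdι (X.map f.op x) := by
  rw [sdι, sdι, ← yonedaEquiv_symm_naturality_left, Functor.map_comp]
  exact stdSimplex.sdIso.inv.naturality_assoc f _

lemma sdι_map {n : SimplexCategory} (x : X.obj (op n)) (φ : X ⟶ Y) :
    sdι x ≫ sd.map φ = sdι (φ.app _ x) := by
  rw [sdι, sdι, Category.assoc, ← Functor.map_comp, yonedaEquiv_symm_comp]


/-- `sd` is a left Kan extension along Yoneda, so a map `sd X ⟶ T` is a compatible family of its
restrictions along `sdι`. This gives both the construction (`sdDesc`) and the equality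
(`sdι_comp_injective`) of maps out of `sd X`. -/
lemma sdExAdjunction_homEquiv_app {T : SSet.{u}} (g : sd.obj X ⟶ T) {n : SimplexCategory}
    (x : X.obj (op n)) :
    (sdExAdjunction.homEquiv X T g).app (op n) x = ULift.up (sdι x ≫ g) := by
  have h : sd.{u}.IsLeftKanExtension stdSimplex.sdIso.inv := inferInstance
  exact @Presheaf.uliftYonedaAdjunction_homEquiv_app.{0} SimplexCategory _ SSet.{u} _
    SimplexCategory.sd _ sd stdSimplex.sdIso.inv h X T g (op n) x

lemma sdι_comp_injective {T : SSet.{u}} {g h : sd.obj X ⟶ T}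
    (H : ∀ (n : SimplexCategory) (x : X.obj (op n)), sdι x ≫ g = sdι x ≫ h) : g = h := by
  refine (sdExAdjunction.homEquiv X T).injective ?_
  ext n x
  exact (sdExAdjunction_homEquiv_app g x).trans
    ((congrArg ULift.up (H _ x)).trans (sdExAdjunction_homEquiv_app h x).symm)

/-- The map from the subdivision of `X` given by a compatible family of maps from the
subdivisions of simplices. -/
noncomputable def sdDesc {T : SSet.{u}}
    (a : ∀ {n : SimplexCategory} (_ : X.obj (op n)), SimplexCategory.sd.{u}.obj n ⟶ T)
    (ha : ∀ {n m : SimplexCategory} (f : m ⟶ n) (x : X.obj (op n)),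
      SimplexCategory.sd.map f ≫ a x = a (X.map f.op x)) : sd.obj X ⟶ T :=
  (sdExAdjunction.homEquiv X T).symm
    { app n := ↾fun x => ULift.up (a (n := n.unop) x)
      naturality n m f := by
        ext x
        exact congrArg ULift.up (ha f.unop x).symm }

lemma sdι_sdDesc {T : SSet.{u}}
    (a : ∀ {n : SimplexCategory} (_ : X.obj (op n)), SimplexCategory.sd.{u}.obj n ⟶ T)
    (ha : ∀ {n m : SimplexCategory} (f : m ⟶ n) (x : X.obj (op n)),
      SimplexCategory.sd.map f ≫ a x = a (X.map f.op x))
    {n : SimplexCategory} (x : X.obj (op n)) : sdι x ≫ sdDesc a ha = a x := by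
  have h := sdExAdjunction_homEquiv_app (sdDesc a ha) x
  rw [sdDesc, Equiv.apply_symm_apply] at h
  exact (congrArg ULift.down h).symm

lemma sd_map_sdVertexMap_app (j : X ⟶ nerve Q) {n m : SimplexCategory} (f : m ⟶ n)
    (x : X.obj (op n)) :
    SimplexCategory.sd.map f ≫ sdVertexMap (j.app _ x) = sdVertexMap (j.app _ (X.map f.op x)) :=
  (sd_map_sdVertexMap f _).trans
    (congrArg sdVertexMap (ConcreteCategory.congr_hom (j.naturality f.op) x).symm)

/-- The map from the subdivision of `X` to the nerve of the chains of `Q`. -/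
noncomputable def sdToNerve (j : X ⟶ nerve Q) : sd.obj X ⟶ nerve (NonemptyFiniteChains Q) :=
  sdDesc (fun x => sdVertexMap (j.app _ x)) (sd_map_sdVertexMap_app j)

lemma sdι_sdToNerve (j : X ⟶ nerve Q) {n : SimplexCategory} (x : X.obj (op n)) :
    sdι x ≫ sdToNerve j = sdVertexMap (j.app _ x) :=
  sdι_sdDesc (fun x => sdVertexMap (j.app _ x)) (sd_map_sdVertexMap_app j) x

variable (X) in
/-- The subcomplex of the subdivision of `X` consisting of the simplices in the subdivision of
some simplex of `X`. -/
noncomputable def sdRange : (sd.obj X).Subcomplex :=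
  ⨆ p : Σ n : SimplexCategory, X.obj (op n), Subcomplex.range (sdι p.2)

/-- All maps `sdι x` factor through the subcomplex `sdRange X`, hence so does the identity of `sd
X`, and the subcomplex is everything. -/
lemma exists_sdι {m : SimplexCategoryᵒᵖ} (z : (sd.obj X).obj m) :
    ∃ (n : SimplexCategory) (x : X.obj (op n)) (c : (SimplexCategory.sd.obj n).obj m),
      (sdι x).app m c = z := by
  have hx {n : SimplexCategory} (x : X.obj (op n)) : Subcomplex.range (sdι x) ≤ sdRange X :=
    le_iSup (fun p : Σ n : SimplexCategory, X.obj (op n) => Subcomplex.range (sdι p.2)) ⟨n, x⟩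
  let r : sd.obj X ⟶ sdRange X :=
    sdDesc (fun x => Subcomplex.lift (sdι x) (hx x)) fun f x => by
      rw [← cancel_mono (sdRange X).ι]
      exact sd_map_sdι f x
  have hr : r ≫ (sdRange X).ι = 𝟙 _ := sdι_comp_injective fun n x => by
    rw [← Category.assoc, sdι_sdDesc, Category.comp_id]
    rfl
  have hz : z ∈ (sdRange X).obj m := by
    have h := ConcreteCategory.congr_hom (NatTrans.congr_app hr m) z
    exact Eq.subst (motive := fun z => z ∈ (sdRange X).obj m) h (r.app m z).2
  rw [sdRange, Subfunctor.iSup_obj, Set.mem_iUnion] at hz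
  obtain ⟨⟨n, x⟩, c, hc⟩ := hz
  exact ⟨n, x, c, hc⟩

lemma sd_map_sdToNerve (φ : X ⟶ Y) (j : Y ⟶ nerve Q) :
    sd.map φ ≫ sdToNerve j = sdToNerve (φ ≫ j) :=
  sdι_comp_injective fun n x => by
    rw [← Category.assoc, sdι_map, sdι_sdToNerve, sdι_sdToNerve]
    rfl

end

end SSet

/-! ### The subdivision as a full subcomplex of the nerve of chains -/

namespace SSet

open PartialOrder Opposite

section

variable {Q : Type u} [PartialOrder Q]

lemma vertexMap_injective_of_strictMono {n : SimplexCategory} {s : (nerve Q).obj (op n)}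
    (h : StrictMono s.obj) : Function.Injective (vertexMap s) :=
  fun _ _ hij => ULift.ext _ _ (h.injective hij)

/-- A finite chain is the set of vertices of a nondegenerate simplex. -/
lemma exists_vertexMap_eq (F : NonemptyFiniteChains Q) :
    ∃ (k : SimplexCategory) (s : (nerve Q).obj (op k)), Function.Injective (vertexMap s) ∧
      ∀ q, q ∈ F.finset ↔ ∃ i, vertexMap s i = q := by
  classical
  let _ : LinearOrder F.finset :=
    { (inferInstance : PartialOrder F.finset) with
      le_total := F.comparable
      toDecidableLE := Classical.decRel _ }
  -- `[m]` has `m + 1` elements, so the dimension is the cardinality minus one; nonemptiness makes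
  -- the truncated subtraction exact.
  have hc : Fintype.card F.finset = (F.finset.card - 1) + 1 := by
    have := F.nonempty.card_pos
    rw [Fintype.card_coe]
    omega
  let e := monoEquivOfFin F.finset hc
  have he : Monotone fun i => (e i : Q) := fun i j h => e.monotone h
  refine ⟨.mk (F.finset.card - 1), he.functor, fun i j hij => ?_, fun q => ⟨fun hq => ?_, ?_⟩⟩
  · exact ULift.ext _ _ (e.injective (Subtype.ext hij))
  · exact ⟨⟨e.symm ⟨q, hq⟩⟩, congrArg Subtype.val (e.apply_symm_apply ⟨q, hq⟩)⟩
  · rintro ⟨i, rfl⟩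
    exact (e i.down).2

/-- The morphism in the simplex category given by a simplex of the nerve of an ordinal. -/
def homOfNerve {m n : SimplexCategory} (s : (nerve (ULift.{u} (Fin (n.len + 1)))).obj (op m)) :
    m ⟶ n :=
  SimplexCategory.Hom.mk ⟨fun i => (s.obj i).down, fun _ _ h => s.monotone h⟩

lemma ordinalMap_homOfNerve {m n : SimplexCategory}
    (s : (nerve (ULift.{u} (Fin (n.len + 1)))).obj (op m)) :
    ordinalMap (homOfNerve s) = vertexMap s :=
  rfl

lemma sdChain_ext {n m : SimplexCategory} {c d : (SimplexCategory.sd.{u}.obj n).obj (op m)}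
    (h : ∀ i, sdChain c i = sdChain d i) : c = d :=
  nerve_ext (Q := NonemptyFiniteChains (ULift.{u} (Fin (n.len + 1)))) h

/-- The simplex of the subdivision of a simplex given by a monotone family of chains. -/
lemma exists_sdChain_eq {n m : SimplexCategory}
    (a : ULift.{u} (Fin (m.len + 1)) →o NonemptyFiniteChains (ULift.{u} (Fin (n.len + 1)))) :
    ∃ c : (SimplexCategory.sd.{u}.obj n).obj (op m), ∀ i, sdChain c i = a i :=
  ⟨(show Monotone fun i => a ⟨i⟩ from fun _ _ h => a.monotone h).functor, fun _ => rfl⟩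

/-- A simplex of the nerve of the chains of `Q` all of whose chains consist of vertices of `s`
lies in the subdivision of `s`. -/
lemma exists_sdVertexMap_eq {n m : SimplexCategory} (s : (nerve Q).obj (op n))
    (t : (nerve (NonemptyFiniteChains Q)).obj (op m))
    (h : ∀ i, ∀ q ∈ (vertexMap t i).finset, ∃ k, vertexMap s k = q) :
    ∃ c : (SimplexCategory.sd.{u}.obj n).obj (op m), (sdVertexMap s).app _ c = t := by
  classical
  -- Pull each chain of `t` back along `s`: every nonempty subset of an ordinal is a chain, and the
  -- hypothesis makes the image of the preimage the whole chain.
  obtain ⟨c, hc⟩ := exists_sdChain_eq (n := n) (m := m)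
    { toFun i :=
        { finset := Finset.univ.filter fun k => vertexMap s k ∈ (vertexMap t i).finset
          nonempty := by
            obtain ⟨q, hq⟩ := (vertexMap t i).nonempty
            obtain ⟨k, rfl⟩ := h i q hq
            exact ⟨k, by simpa using hq⟩
          comparable a b := le_total _ _ }
      monotone' i j hij k hk := by
        simp only [Finset.mem_filter, Finset.mem_univ, true_and] at hk ⊢
        exact (vertexMap t).monotone hij hk }
  refine ⟨c, nerve_ext fun i => ?_⟩
  rw [vertexMap_sdVertexMap, hc]
  refine NonemptyFiniteChains.ext (Finset.ext fun q => ?_)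
  rw [NonemptyFiniteChains.mem_map_iff]
  constructor
  · rintro ⟨k, hk, rfl⟩
    exact (Finset.mem_filter.1 hk).2
  · intro hq
    obtain ⟨k, rfl⟩ := h i q hq
    exact ⟨k, Finset.mem_filter.2 ⟨Finset.mem_univ _, hq⟩, rfl⟩

lemma le_sdChain_last {n m : SimplexCategory} (c : (SimplexCategory.sd.{u}.obj n).obj (op m))
    (i) : sdChain c i ≤ sdChain c ⟨Fin.last _⟩ :=
  (sdChain c).monotone (Fin.le_last _)

/-- Every simplex in the subdivision of a simplex comes from the face spanned by the largest
chain. -/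
lemma exists_face_sdChain {n m : SimplexCategory}
    (c : (SimplexCategory.sd.{u}.obj n).obj (op m)) :
    ∃ (k : SimplexCategory) (g : k ⟶ n) (d : (SimplexCategory.sd.{u}.obj k).obj (op m)),
      Function.Injective (ordinalMap.{u} g) ∧ (SimplexCategory.sd.map g).app _ d = c ∧
      ∀ q, q ∈ (sdChain d ⟨Fin.last _⟩).finset := by
  obtain ⟨k, s, hs, hs'⟩ := exists_vertexMap_eq (sdChain c ⟨Fin.last _⟩)
  obtain ⟨d, hd⟩ := exists_sdVertexMap_eq s c fun i q hq =>
    (hs' q).1 (le_sdChain_last c i hq)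
  refine ⟨k, homOfNerve s, d, hs, hd, fun q => ?_⟩
  have h₁ := (hs' (vertexMap s q)).2 ⟨q, rfl⟩
  have h₂ : sdChain c ⟨Fin.last _⟩ = (sdChain d ⟨Fin.last _⟩).map (vertexMap s) := by
    rw [← vertexMap_sdVertexMap, hd]
    rfl
  rw [h₂, NonemptyFiniteChains.mem_map_iff] at h₁
  obtain ⟨q', hq', h⟩ := h₁
  exact hs h ▸ hq'

variable {X Y : SSet.{u}}

lemma app_injective_of_mono (j : X ⟶ Y) [Mono j] (n) : Function.Injective (j.app n) :=
  (mono_iff_injective _).1 inferInstance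

/-- The chains of `Q` which are the sets of vertices of simplices of `X`. -/
def chainSet (j : X ⟶ nerve Q) : Set (NonemptyFiniteChains Q) :=
  {F | ∃ (n : SimplexCategory) (x : X.obj (op n)),
    ∀ q, q ∈ F.finset ↔ ∃ i, vertexMap (j.app _ x) i = q}

lemma vertexMap_app_map (j : X ⟶ nerve Q) {n m : SimplexCategory} (f : m ⟶ n)
    (x : X.obj (op n)) :
    vertexMap (j.app _ (X.map f.op x)) = (vertexMap (j.app _ x)).comp (ordinalMap f) :=
  congrArg vertexMap (ConcreteCategory.congr_hom (j.naturality f.op) x)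

lemma sdι_app_map {n m k : SimplexCategory} (f : m ⟶ n) (x : X.obj (op n))
    (c : (SimplexCategory.sd.{u}.obj m).obj (op k)) :
    (sdι x).app _ ((SimplexCategory.sd.map f).app _ c) = (sdι (X.map f.op x)).app _ c :=
  ConcreteCategory.congr_hom (NatTrans.congr_app (sd_map_sdι f x) _) c

lemma sdToNerve_sdι (j : X ⟶ nerve Q) {n m : SimplexCategory} (x : X.obj (op n))
    (c : (SimplexCategory.sd.{u}.obj n).obj (op m)) :
    (sdToNerve j).app _ ((sdι x).app _ c) = (sdVertexMap (j.app _ x)).app _ c := by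
  rw [← sdι_sdToNerve j x, NatTrans.comp_app, ConcreteCategory.comp_apply]

/-- Every simplex of the subdivision of `X` lies in the interior of the subdivision of a
nondegenerate simplex. -/
lemma exists_nonDegenerate_sdι (j : X ⟶ nerve Q) [Mono j] {m : SimplexCategory}
    (z : (sd.obj X).obj (op m)) :
    ∃ (n : SimplexCategory) (x : X.obj (op n)) (c : (SimplexCategory.sd.obj n).obj (op m)),
      (sdι x).app _ c = z ∧ Function.Injective (vertexMap (j.app _ x)) ∧
      ∀ q, q ∈ (sdChain c ⟨Fin.last _⟩).finset := by
  obtain ⟨n, x, c, rfl⟩ := exists_sdι z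
  induction n using SimplexCategory.rec with | _ n
  obtain ⟨N, f, _, y, rfl⟩ := X.exists_nonDegenerate x
  -- A monomorphism preserves nondegeneracy, which in the nerve of a poset means strictly increasing
  -- vertices.
  have hy : Function.Injective (vertexMap (j.app _ y.1)) :=
    vertexMap_injective_of_strictMono ((mem_nerve_nonDegenerate_iff_strictMono _).1
      ((nonDegenerate_iff_of_mono j y.1).2 y.2))
  rw [← sdι_app_map]
  obtain ⟨k, g, d, hg, hd, hd'⟩ := exists_face_sdChain ((SimplexCategory.sd.map f).app _ c)
  refine ⟨k, X.map g.op y.1, d, ?_, ?_, hd'⟩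
  · rw [← sdι_app_map, hd]
  · rw [vertexMap_app_map]
    exact hy.comp hg

lemma mem_vertexMap_last (j : X ⟶ nerve Q) {n m : SimplexCategory} {x : X.obj (op n)}
    {c : (SimplexCategory.sd.obj n).obj (op m)} (hc : ∀ q, q ∈ (sdChain c ⟨Fin.last _⟩).finset)
    (q : Q) :
    q ∈ (vertexMap ((sdToNerve j).app _ ((sdι x).app _ c)) ⟨Fin.last _⟩).finset ↔
      q ∈ Set.range (vertexMap (j.app _ x)) := by
  rw [sdToNerve_sdι, vertexMap_sdVertexMap, NonemptyFiniteChains.mem_map_iff]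
  exact ⟨fun ⟨i, _, h⟩ => ⟨i, h⟩, fun ⟨i, h⟩ => ⟨i, hc i, h⟩⟩

/-- A strictly increasing map from a finite ordinal is determined by its range. -/
lemma eq_of_range_vertexMap_eq {n : SimplexCategory} {s t : (nerve Q).obj (op n)}
    (hs : Function.Injective (vertexMap s)) (ht : Function.Injective (vertexMap t))
    (h : Set.range (vertexMap s) = Set.range (vertexMap t)) : s = t := by
  have h' : ⇑(vertexMap s) = vertexMap t :=
    ((vertexMap s).monotone.strictMono_of_injective hs).range_inj
      ((vertexMap t).monotone.strictMono_of_injective ht) |>.1 h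
  exact nerve_ext fun i => congrFun h' i

lemma map_injective {P R : Type*} [PartialOrder P] [PartialOrder R] {f : P →o R}
    (hf : Function.Injective f) : Function.Injective fun F : NonemptyFiniteChains P => F.map f := by
  intro F G h
  ext q
  have := congrArg (fun F : NonemptyFiniteChains R => f q ∈ F.finset) h
  simpa [hf.eq_iff] using this

/-- Place each simplex in the interior of the subdivision of a nondegenerate `x`. The last chain of
its image is the vertex set of `x`, which recovers `x` because `j` is mono; injectivity on vertices
then recovers the position inside `x`. -/
instance mono_sdToNerve (j : X ⟶ nerve Q) [Mono j] : Mono (sdToNerve j) := by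
  rw [NatTrans.mono_iff_mono_app]
  intro ⟨m⟩
  rw [mono_iff_injective]
  intro z z' h
  obtain ⟨n, x, c, rfl, hx, hc⟩ := exists_nonDegenerate_sdι j z
  obtain ⟨n', x', c', rfl, hx', hc'⟩ := exists_nonDegenerate_sdι j z'
  have hr : Set.range (vertexMap (j.app _ x)) = Set.range (vertexMap (j.app _ x')) := by
    ext q
    rw [← mem_vertexMap_last j hc, ← mem_vertexMap_last j hc', h]
  obtain rfl : n = n' := by
    have h₁ := Set.ncard_range_of_injective hx
    have h₂ := Set.ncard_range_of_injective hx'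
    rw [hr, h₂] at h₁
    simp only [Nat.card_eq_fintype_card, Fintype.card_ulift, Fintype.card_fin] at h₁
    exact SimplexCategory.ext (by omega)
  obtain rfl : x = x' := app_injective_of_mono j _ (eq_of_range_vertexMap_eq hx hx' hr)
  obtain rfl : c = c' := by
    refine sdChain_ext fun i => map_injective hx ?_
    rw [sdToNerve_sdι, sdToNerve_sdι] at h
    exact congrArg (fun t => vertexMap t i) h
  rfl

/-- The chains of `t` increase, so they all lie in the last one: a simplex of `X` spanning that
chain contains the rest as faces. Conversely, faces of simplices of `X` are in `X`. -/
lemma mem_range_sdToNerve (j : X ⟶ nerve Q) {m : SimplexCategory}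
    (t : (nerve (NonemptyFiniteChains Q)).obj (op m)) :
    t ∈ Set.range ((sdToNerve j).app (op m)) ↔ ∀ i, vertexMap t i ∈ chainSet j := by
  constructor
  · rintro ⟨z, rfl⟩ i
    obtain ⟨n, x, c, rfl⟩ := exists_sdι z
    obtain ⟨k, s, -, hs⟩ := exists_vertexMap_eq (sdChain c i)
    refine ⟨k, X.map (homOfNerve s).op x, fun q => ?_⟩
    rw [sdToNerve_sdι, vertexMap_sdVertexMap, NonemptyFiniteChains.mem_map_iff,
      vertexMap_app_map, ordinalMap_homOfNerve]
    constructor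
    · rintro ⟨p, hp, rfl⟩
      obtain ⟨i, rfl⟩ := (hs p).1 hp
      exact ⟨i, rfl⟩
    · rintro ⟨i, rfl⟩
      exact ⟨_, (hs _).2 ⟨i, rfl⟩, rfl⟩
  · intro h
    obtain ⟨n, x, hx⟩ := h ⟨Fin.last _⟩
    obtain ⟨c, hc⟩ := exists_sdVertexMap_eq (j.app _ x) t fun i q hq =>
      (hx q).1 ((vertexMap t).monotone (Fin.le_last i.down) hq)
    exact ⟨(sdι x).app _ c, (sdToNerve_sdι j x c).trans hc⟩

/-- The chains of a full subcomplex of the nerve of `Q`. -/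
lemma chainSet_eq (j : X ⟶ nerve Q) (S : Set Q)
    (h : ∀ (m : SimplexCategory) (t : (nerve Q).obj (op m)),
      t ∈ Set.range (j.app (op m)) ↔ ∀ i, vertexMap t i ∈ S) :
    chainSet j = {F | ∀ q ∈ F.finset, q ∈ S} := by
  ext F
  constructor
  · rintro ⟨n, x, hx⟩ q hq
    obtain ⟨i, rfl⟩ := (hx q).1 hq
    exact (h n _).1 ⟨x, rfl⟩ i
  · intro hF
    obtain ⟨k, s, -, hs⟩ := exists_vertexMap_eq F
    obtain ⟨x, rfl⟩ := (h k s).2 fun i => hF _ ((hs _).2 ⟨i, rfl⟩)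
    exact ⟨k, x, hs⟩

end

end SSet

/-! ### Full subcomplexes of nerves of posets as nerve models -/

namespace SSet

open PartialOrder Opposite TwoCat

section

variable {P : Type u} [PartialOrder P] {X Y : SSet.{u}}

/-- A simplicial set over the nerve of `P` whose image is the full subcomplex on `S`. -/
def IsFullOn (j : X ⟶ nerve P) (S : Set P) : Prop :=
  ∀ (m : SimplexCategory) (t : (nerve P).obj (op m)),
    t ∈ Set.range (j.app (op m)) ↔ ∀ i, vertexMap t i ∈ S

lemma vertexMap_δ (j : X ⟶ nerve P) {n : ℕ} (x : X.obj (op (.mk (n + 1)))) (i : Fin (n + 2))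
    (k : Fin (n + 1)) :
    vertexMap (j.app _ (X.δ i x)) ⟨k⟩ = vertexMap (j.app _ x) ⟨i.succAbove k⟩ :=
  DFunLike.congr_fun (vertexMap_app_map j (SimplexCategory.δ i) x) ⟨k⟩

lemma eq_of_vertexMap_eq (j : X ⟶ nerve P) [Mono j] {n : ℕ} {x y : X.obj (op (.mk n))}
    (h : ∀ k : Fin (n + 1), vertexMap (j.app _ x) ⟨k⟩ = vertexMap (j.app _ y) ⟨k⟩) : x = y :=
  app_injective_of_mono j _ (nerve_ext fun i => h i.down)

namespace IsFullOn

variable {j : X ⟶ nerve P} {S : Set P}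

lemma vertexMap_mem (h : IsFullOn j S) {n : SimplexCategory} (x : X.obj (op n)) (i) :
    vertexMap (j.app _ x) i ∈ S :=
  (h _ _).1 ⟨x, rfl⟩ i

lemma exists_vertexMap (h : IsFullOn j S) {n : ℕ} (f : Fin (n + 1) → P) (hf : Monotone f)
    (hS : ∀ k, f k ∈ S) :
    ∃ x : X.obj (op (.mk n)), ∀ k, vertexMap (j.app _ x) ⟨k⟩ = f k := by
  obtain ⟨x, hx⟩ := (h (.mk n) hf.functor).2 fun i => hS i.down
  exact ⟨x, fun k => congrArg (fun s => vertexMap (n := .mk n) s ⟨k⟩) hx⟩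

end IsFullOn

section

variable (j : X ⟶ nerve P) {x y z : X.obj (op (.mk 0))}

lemma vertexMap_edge_zero (e : Edge x y) :
    vertexMap (j.app _ e.edge) ⟨0⟩ = vertexMap (j.app _ x) ⟨0⟩ := by
  have h := vertexMap_δ j e.edge 1 0
  rw [e.src_eq] at h
  exact h.symm

lemma vertexMap_edge_one (e : Edge x y) :
    vertexMap (j.app _ e.edge) ⟨1⟩ = vertexMap (j.app _ y) ⟨0⟩ := by
  have h := vertexMap_δ j e.edge 0 0
  rw [e.tgt_eq] at h
  exact h.symm

variable {e₀₁ : Edge x y} {e₁₂ : Edge y z} {e₀₂ : Edge x z}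

lemma vertexMap_simplex_zero (h : Edge.CompStruct e₀₁ e₁₂ e₀₂) :
    vertexMap (j.app _ h.simplex) ⟨0⟩ = vertexMap (j.app _ x) ⟨0⟩ := by
  have h' := vertexMap_δ j h.simplex 2 0
  rw [h.d₂, vertexMap_edge_zero] at h'
  exact h'.symm

lemma vertexMap_simplex_one (h : Edge.CompStruct e₀₁ e₁₂ e₀₂) :
    vertexMap (j.app _ h.simplex) ⟨1⟩ = vertexMap (j.app _ y) ⟨0⟩ := by
  have h' := vertexMap_δ j h.simplex 2 1
  rw [h.d₂, vertexMap_edge_one] at h'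
  exact h'.symm

lemma vertexMap_simplex_two (h : Edge.CompStruct e₀₁ e₁₂ e₀₂) :
    vertexMap (j.app _ h.simplex) ⟨2⟩ = vertexMap (j.app _ z) ⟨0⟩ := by
  have h' := vertexMap_δ j h.simplex 0 1
  rw [h.d₀, vertexMap_edge_one] at h'
  exact h'.symm

end

lemma edge_le (j : X ⟶ nerve P) {x y : X.obj (op (.mk 0))} (e : Edge x y) :
    vertexMap (j.app _ x) ⟨0⟩ ≤ vertexMap (j.app _ y) ⟨0⟩ := by
  rw [← vertexMap_edge_zero j e, ← vertexMap_edge_one j e]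
  exact (vertexMap (j.app _ e.edge)).monotone (show (0 : Fin 2) ≤ 1 from Fin.zero_le _)

/-- A simplicial set isomorphic to a full subcomplex of a nerve is a model of this nerve. -/
noncomputable def IsFullOn.nerveModel {j : X ⟶ nerve P} [Mono j] {S : Set P}
    (hj : IsFullOn j S) : NerveModel X S where
  pt x := vertexMap (j.app _ x) ⟨0⟩
  pt_injective x y h := eq_of_vertexMap_eq j fun k => by
    obtain rfl : k = 0 := Subsingleton.elim (α := Fin 1) _ _
    exact h
  range_pt := by
    ext p
    constructor
    · rintro ⟨x, rfl⟩
      exact hj.vertexMap_mem x _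
    · intro hp
      obtain ⟨x, hx⟩ := hj.exists_vertexMap (n := 0) (fun _ => p) monotone_const fun _ => hp
      exact ⟨x, hx 0⟩
  le_of_edge e := edge_le j e
  subsingleton_edge x y := ⟨fun e e' => Edge.ext (eq_of_vertexMap_eq j fun k => by
    fin_cases k
    · exact (vertexMap_edge_zero j e).trans (vertexMap_edge_zero j e').symm
    · exact (vertexMap_edge_one j e).trans (vertexMap_edge_one j e').symm)⟩
  nonempty_edge {x y} h := by
    obtain ⟨e, he⟩ := hj.exists_vertexMap
      ![vertexMap (j.app _ x) ⟨0⟩, vertexMap (j.app _ y) ⟨0⟩]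
      (Fin.monotone_iff_le_succ.2 fun i => by fin_cases i; exact h)
      fun k => by fin_cases k <;> exact hj.vertexMap_mem _ _
    refine ⟨Edge.mk e (eq_of_vertexMap_eq j fun k => ?_) (eq_of_vertexMap_eq j fun k => ?_)⟩
    all_goals
      obtain rfl : k = 0 := Subsingleton.elim (α := Fin 1) _ _
      exact (vertexMap_δ j _ _ _).trans (he _)
  subsingleton_compStruct e₀₁ e₁₂ e₀₂ :=
    ⟨fun h h' => Edge.CompStruct.ext (eq_of_vertexMap_eq j fun k => by
      fin_cases k
      · exact (vertexMap_simplex_zero j h).trans (vertexMap_simplex_zero j h').symm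
      · exact (vertexMap_simplex_one j h).trans (vertexMap_simplex_one j h').symm
      · exact (vertexMap_simplex_two j h).trans (vertexMap_simplex_two j h').symm)⟩
  nonempty_compStruct {x y z} e₀₁ e₁₂ e₀₂ := by
    obtain ⟨s, hs⟩ := hj.exists_vertexMap
      ![vertexMap (j.app _ x) ⟨0⟩, vertexMap (j.app _ y) ⟨0⟩, vertexMap (j.app _ z) ⟨0⟩]
      (Fin.monotone_iff_le_succ.2 fun i => by
        fin_cases i
        exacts [edge_le j e₀₁, edge_le j e₁₂])
      fun k => by fin_cases k <;> exact hj.vertexMap_mem _ _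
    refine ⟨Edge.CompStruct.mk s (eq_of_vertexMap_eq j fun k => ?_)
      (eq_of_vertexMap_eq j fun k => ?_) (eq_of_vertexMap_eq j fun k => ?_)⟩
    all_goals
      rw [vertexMap_δ, hs]
      fin_cases k
      · exact (vertexMap_edge_zero j _).symm
      · exact (vertexMap_edge_one j _).symm
  exists_tetra {x₀ x₁ x₂ x₃ e₀₁ e₁₂ e₂₃ e₀₂ e₁₃ e₀₃} h₀₁₂ h₀₂₃ h₁₂₃ h₀₁₃ := by
    obtain ⟨τ, hτ⟩ := hj.exists_vertexMap
      ![vertexMap (j.app _ x₀) ⟨0⟩, vertexMap (j.app _ x₁) ⟨0⟩, vertexMap (j.app _ x₂) ⟨0⟩,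
        vertexMap (j.app _ x₃) ⟨0⟩]
      (Fin.monotone_iff_le_succ.2 fun i => by
        fin_cases i
        exacts [edge_le j e₀₁, edge_le j e₁₂, edge_le j e₂₃])
      fun k => by fin_cases k <;> exact hj.vertexMap_mem _ _
    refine ⟨τ, eq_of_vertexMap_eq j fun k => ?_, eq_of_vertexMap_eq j fun k => ?_,
      eq_of_vertexMap_eq j fun k => ?_, eq_of_vertexMap_eq j fun k => ?_⟩
    all_goals
      rw [vertexMap_δ, hτ]
      fin_cases k
      · exact (vertexMap_simplex_zero j _).symm
      · exact (vertexMap_simplex_one j _).symm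
      · exact (vertexMap_simplex_two j _).symm

end

namespace NerveModel

variable {X Y : SSet.{u}} {P : Type u'} [PartialOrder P] {S S' : Set P}

lemma supp_map (M : NerveModel X S) (N : NerveModel Y S') (φ : X ⟶ Y)
    (h : ∀ x, N.pt (φ.app _ x) = M.pt x) {x y : C₂ X} (f : x ⟶ y) :
    N.supp ((C₂.map φ).map f) = M.supp f := by
  induction f using C₂.hom_induction with
  | id x =>
    refine (congrArg N.supp ((C₂.map φ).map_id x)).trans ?_
    rw [supp_id, supp_id]
    exact congrArg (fun p => ({p} : Set P)) (h _)
  | @comp x y z f e ih =>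
    refine (congrArg N.supp ((C₂.map φ).map_comp f (edg e))).trans ?_
    rw [supp_comp, supp_comp, ih]
    congr 1
    have h₁ : (C₂.map φ).map (edg e) = edg (x := ⟨φ.app _ y.pt⟩) (y := ⟨φ.app _ z.pt⟩)
      (e.map φ) := C₂.map₁_arr φ e
    refine (congrArg N.supp h₁).trans ((N.supp_edg (e.map φ)).trans ?_)
    rw [supp_edg, ← h, ← h]

end NerveModel

end SSet

/-! ### The retraction on chains, and the conclusion -/

namespace PartialOrder.NonemptyFiniteChains

variable {P : Type u} [PartialOrder P]

open scoped Classical in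
/-- The largest subchain contained in `S`, if it is nonempty. -/
noncomputable def restrict (S : Set P) (F : NonemptyFiniteChains P) : NonemptyFiniteChains P :=
  if h : ∃ p ∈ F.finset, p ∈ S then
    { finset := F.finset.filter (· ∈ S)
      nonempty := by simpa [Finset.filter_nonempty_iff] using h
      comparable := fun a b => F.comparable ⟨a, (Finset.mem_filter.1 a.2).1⟩
        ⟨b, (Finset.mem_filter.1 b.2).1⟩ }
  -- A default value; only chains meeting `S` matter.
  else F

lemma mem_restrict {S : Set P} {F : NonemptyFiniteChains P} (h : ∃ p ∈ F.finset, p ∈ S) (p : P) :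
    p ∈ (restrict S F).finset ↔ p ∈ F.finset ∧ p ∈ S := by
  classical
  rw [restrict, dif_pos h]
  exact Finset.mem_filter

end PartialOrder.NonemptyFiniteChains

namespace SSet

open PartialOrder Opposite TwoCat

variable {X Y : SSet.{u}} {Q : Type u} [PartialOrder Q]

/-- The image of one subdivision is full on `chainSet`, whatever `X` is; so at the second step the
admissible chains are simply all chains of points of `chainSet j`. -/
lemma isFullOn_sdToNerve_sdToNerve (j : X ⟶ nerve Q) :
    IsFullOn (sdToNerve (sdToNerve j)) {G | ∀ F ∈ G.finset, F ∈ chainSet j} := by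
  have h : IsFullOn (sdToNerve j) (chainSet j) := fun _ t => mem_range_sdToNerve j t
  have h' : IsFullOn (sdToNerve (sdToNerve j)) (chainSet (sdToNerve j)) :=
    fun _ t => mem_range_sdToNerve (sdToNerve j) t
  exact chainSet_eq (sdToNerve j) (chainSet j) h ▸ h'

namespace IsFullOn

lemma nerveModel_pt_app {P : Type u} [PartialOrder P] {jX : X ⟶ nerve P} {jY : Y ⟶ nerve P}
    [Mono jX] [Mono jY] {S S' : Set P} (hX : IsFullOn jX S) (hY : IsFullOn jY S') {φ : X ⟶ Y}
    (h : φ ≫ jY = jX) (x : X.obj (op (.mk 0))) :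
    hY.nerveModel.pt (φ.app _ x) = hX.nerveModel.pt x := by
  subst h
  rfl

/-- An inclusion of full subcomplexes of the nerve of `P` induces a skew immersion if there is a
retraction onto the smaller one, defined on its upward closure. -/
lemma isSkewImmersion {P : Type u} [PartialOrder P] {jX : X ⟶ nerve P} {jY : Y ⟶ nerve P}
    [Mono jX] [Mono jY] {S S' V : Set P} (hX : IsFullOn jX S) (hY : IsFullOn jY S') {φ : X ⟶ Y}
    (h : φ ≫ jY = jX) (hS : ∀ p ∈ S', ∀ q ∈ S, p ≤ q → p ∈ S) (hVS' : V ⊆ S')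
    (hV : ∀ p ∈ V, ∀ q ∈ S', p ≤ q → q ∈ V) (hSV : S ⊆ V) (r : P → P) (hr : ∀ p ∈ V, r p ∈ S)
    (hr_mono : ∀ p ∈ V, ∀ q ∈ V, p ≤ q → r p ≤ r q) (hr_le : ∀ p ∈ V, r p ≤ p)
    (hr_self : ∀ p ∈ S, r p = p) : IsSkewImmersion (C₂.map φ) :=
  ChainSupport.isSkewImmersion hX.nerveModel.chainSupport hY.nerveModel.chainSupport _
    (fun _ => nerveModel_pt_app hX hY h _)
    (hX.nerveModel.supp_map hY.nerveModel _ (nerveModel_pt_app hX hY h))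
    hS hVS' hV hSV r hr hr_mono hr_le hr_self

end IsFullOn

lemma sd_map_sd_map_sdToNerve_sdToNerve (φ : X ⟶ Y) (j : Y ⟶ nerve Q) :
    sd.map (sd.map φ) ≫ sdToNerve (sdToNerve j) = sdToNerve (sdToNerve (φ ≫ j)) := by
  rw [sd_map_sdToNerve, sd_map_sdToNerve]

/-- The double subdivision of an inclusion of simplicial subsets of the nerve of a partial order
induces a skew immersion of 2-categories. -/
theorem isSkewImmersion_C₂_map_sd_map_sd_map (φ : X ⟶ Y) [Mono φ] (j : Y ⟶ nerve Q) [Mono j] :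
    IsSkewImmersion (C₂.map (sd.map (sd.map φ))) := by
  have hX := isFullOn_sdToNerve_sdToNerve (φ ≫ j)
  have hY := isFullOn_sdToNerve_sdToNerve j
  have hle : chainSet (φ ≫ j) ⊆ chainSet j := fun F ⟨n, x, hx⟩ => ⟨n, φ.app _ x, hx⟩
  have hex (G : NonemptyFiniteChains (NonemptyFiniteChains Q))
      (hG : ∀ F ∈ G.finset, F ∈ chainSet (φ ≫ j)) : ∃ F ∈ G.finset, F ∈ chainSet (φ ≫ j) :=
    G.nonempty.imp fun F hF => ⟨hF, hG F hF⟩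
  refine hX.isSkewImmersion hY (sd_map_sd_map_sdToNerve_sdToNerve φ j)
    -- The open neighbourhood of the smaller subdivision: chains of simplices of `Y`, at least one
    -- of which comes from `X`. If `X` is empty, as for the horn in `Δ[0]`, it is empty too and no
    -- case distinction is needed.
    (V := {G : NonemptyFiniteChains (NonemptyFiniteChains Q) |
      (∀ F ∈ G.finset, F ∈ chainSet j) ∧ ∃ F ∈ G.finset, F ∈ chainSet (φ ≫ j)})
    (fun G _ H hH h F hF => hH F (h hF)) (fun G hG => hG.1)
    (fun G hG H hH h => ⟨hH, hG.2.imp fun F hF => ⟨h hF.1, hF.2⟩⟩)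
    (fun G hG => ⟨fun F hF => hle (hG F hF), hex G hG⟩)
    (NonemptyFiniteChains.restrict (chainSet (φ ≫ j))) ?_ ?_ ?_ ?_
  · exact fun G hG F hF => ((NonemptyFiniteChains.mem_restrict hG.2 F).1 hF).2
  · intro G hG H hH h F hF
    rw [NonemptyFiniteChains.mem_restrict hG.2] at hF
    exact (NonemptyFiniteChains.mem_restrict hH.2 F).2 ⟨h hF.1, hF.2⟩
  · exact fun G hG F hF => ((NonemptyFiniteChains.mem_restrict hG.2 F).1 hF).1
  · intro G hG
    ext F
    rw [NonemptyFiniteChains.mem_restrict (hex G hG)]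
    exact ⟨And.left, fun hF => ⟨hF, hG F hF⟩⟩

end SSet

theorem mainTheorem4 (n : ℕ) (k : Fin (n + 1)) :
    TwoCat.IsSkewImmersion
      (SSet.C₂.map (SSet.sd.map (SSet.sd.map (SSet.horn.{u} n k).ι))) :=
  SSet.isSkewImmersion_C₂_map_sd_map_sd_map _ (SSet.stdSimplex.isoNerve n).hom
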